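/- Let $S^2\subset\mathbb{R}^3$ be the unit sphere with the round metric, with gradient $\nabla$, Levi-Civita covariant derivative, divergence $\operatorname{div}$, Laplace–Beltrami operator $\Delta=\operatorname{div}\nabla$ and area measure. For functions $f,g$ and tangent vector fields $\boldsymbol v$ on $S^2$ put $$\{f,g\}(\boldsymbol x)=\boldsymbol x\cdot(\nabla f\times\nabla g),\qquad \nabla^\bot\psi=-\boldsymbol x\times\nabla\psi,\qquad \operatorname{curl}\boldsymbol v=\operatorname{div}(\boldsymbol v\times\boldsymbol x).$$ Let $J\subseteq\mathbb{R}$ be an open set of times (for example an open interval). All time-dependent functions and fields below are smooth ($C^\infty$) on $J\times S^2$. A tangent vector field $\boldsymbol v$ and a pressure $p$ solve the incompressible Euler equations if on $J\times S^2$ $$\dot{\boldsymbol v}+\nabla_{\boldsymbol v}\boldsymbol v=-\nabla p,\qquad \operatorname{div}\boldsymbol v=0 .\tag{E}$$ Functions $\omega$ and $\psi$, where $\psi(\cdot,t)$ has mean zero for every $t\in J$, solve the Euler–Arnold (vorticity) equation if on $J\times S^2$ $$\dot\omega+\{\omega,\psi\}=0,\qquad -\Delta\psi=\omega .\tag{V}$$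 The two systems are equivalent, in the following sense. 1. A time-dependent field $\boldsymbol v$ solves (E) for some pressure $p$ if and only if there is a $\psi$ such that $\boldsymbol v=\nabla^\bot\psi$ on $J\times S^2$ and $(\operatorname{curl}\boldsymbol v,\psi)$ solves (V). 2. The stream function is unique: if $\psi_1,\psi_2\in C^\infty(S^2)$ have mean zero and $\nabla^\bot\psi_1=\nabla^\bot\psi_2$, then $\psi_1=\psi_2$. 3. Conversely, if $(\omega,\psi)$ solves (V), then $\boldsymbol v=\nabla^\bot\psi$ solves (E) for some pressure $p$, and $\operatorname{curl}\boldsymbol v=\omega$. Moreover $\omega$ represents the momentum variable of $\psi$ for the Dirichlet inner product: $\int_{S^2}\nabla\psi\cdot\nabla\xi=\int_{S^2}\omega\,\xi$ for all $t\in J$ and all $\xi\in C^\infty(S^2)$. -/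

import Mathlib

namespace SphereHydro

section

open scoped Manifold RealInnerProductSpace EuclideanSpace

/-- Euclidean space `ℝ³`. -/
abbrev E3 : Type := EuclideanSpace ℝ (Fin 3)

/-- The unit sphere `S² ⊂ ℝ³`, with the smooth structure that Mathlib gives it. -/
abbrev S2 : Type := Metric.sphere (0 : E3) 1

noncomputable section

/-- The cross product `a × b` on `ℝ³`. -/
def cross (a b : E3) : E3 := WithLp.toLp 2 (crossProduct a.ofLp b.ofLp)

/-- The point `y / |y|` of the sphere, for `y ≠ 0`. -/
def radialProj (y : E3) (hy : y ≠ 0) : S2 :=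
  ⟨‖y‖⁻¹ • y, by simp [norm_smul, hy]⟩

open Classical in
/-- The radially constant extension `y ↦ F (y / |y|)` of a map `F` on the sphere
(with the irrelevant value `0` at the origin). -/
def radialExt {V : Type*} [Zero V] (F : S2 → V) (y : E3) : V :=
  if hy : y = 0 then 0 else F (radialProj y hy)

/-- The differential of `F : S² → V` at `x`, on `T_x S² = x^⊥ ⊂ ℝ³`, extended by `0` to the normal
line `ℝ x`: for a tangent vector `u`, `tangentDeriv F x u` is the derivative of `F` along any curve
in `S²` through `x` with velocity `u`, and `tangentDeriv F x x = 0`. -/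
def tangentDeriv {V : Type*} [NormedAddCommGroup V] [NormedSpace ℝ V] (F : S2 → V) (x : S2) :
    E3 →L[ℝ] V :=
  fderiv ℝ (radialExt F) (x : E3)

/-- The orthogonal projection `w ↦ w - ⟨x, w⟩ x` of `ℝ³` onto `T_x S²`. -/
def tangentProj (x : S2) : E3 →L[ℝ] E3 :=
  ContinuousLinearMap.id ℝ E3 - (innerSL ℝ (x : E3)).smulRight (x : E3)

/-- A vector field on `S²`, as a map into `ℝ³`, is tangent to the sphere. -/
def IsTangent (v : S2 → E3) : Prop := ∀ x : S2, ⟪(x : E3), v x⟫ = 0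

/-- The Riemannian gradient `∇f` on `S²`: the tangent vector representing the differential. -/
def grad (f : S2 → ℝ) (x : S2) : E3 :=
  (InnerProductSpace.toDual ℝ E3).symm (tangentDeriv f x)

/-- The total covariant derivative `w ↦ ∇_w v` at `x` of a tangent field `v` for the Levi-Civita
connection of the round metric: the tangential part of the derivative of `v` in direction `w`. -/
def covDiff (v : S2 → E3) (x : S2) : E3 →L[ℝ] E3 :=
  (tangentProj x).comp (tangentDeriv v x)

/-- The covariant derivative `∇_u v` of the tangent field `v` along the tangent field `u`. -/
def covDeriv (u v : S2 → E3) (x : S2) : E3 := covDiff v x (u x)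

/-- The Riemannian divergence: the trace of `w ↦ ∇_w v` (the normal line contributes `0`). -/
def div (v : S2 → E3) (x : S2) : ℝ := LinearMap.trace ℝ E3 (covDiff v x : E3 →ₗ[ℝ] E3)

/-- The Laplace-Beltrami operator `Δ = div ∇` on `S²`. -/
def laplacian (f : S2 → ℝ) : S2 → ℝ := div (grad f)

/-- The Poisson bracket `{f, g}(x) = x · (∇f × ∇g)`. -/
def poisson (f g : S2 → ℝ) (x : S2) : ℝ := ⟪(x : E3), cross (grad f x) (grad g x)⟫

/-- The skew gradient (Hamiltonian vector field) `∇^⊥ψ = -x × ∇ψ`. -/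
def skewGrad (ψ : S2 → ℝ) (x : S2) : E3 := -cross (x : E3) (grad ψ x)

/-- The scalar curl `curl v = div (v × x)`, the normal component of the curl in `ℝ³` (for the outer
normal `x`). -/
def curl (v : S2 → E3) : S2 → ℝ := div fun x => cross (v x) (x : E3)

/-- The surface area measure on `S²`. -/
def area : MeasureTheory.Measure S2 := (MeasureTheory.volume : MeasureTheory.Measure E3).toSphere

open scoped ContDiff in
/-- `f` is smooth on the sphere. -/
def IsSmooth (f : S2 → ℝ) : Prop := ContMDiff (𝓡 2) 𝓘(ℝ, ℝ) ∞ f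

open scoped ContDiff in
/-- A time-dependent function or vector field on the sphere is jointly smooth on `J × S²`. -/
def IsSmoothInTime {V : Type*} [NormedAddCommGroup V] [NormedSpace ℝ V] (J : Set ℝ)
    (F : ℝ → S2 → V) : Prop :=
  ContMDiffOn (𝓘(ℝ, ℝ).prod (𝓡 2)) 𝓘(ℝ, V) ∞ (fun z : ℝ × S2 => F z.1 z.2) (J ×ˢ Set.univ)

/-- `(v, p)` is a smooth solution on `J × S²` of the incompressible Euler equations
`∂ₜv + ∇_v v = -∇p`, `div v = 0`, with `v` tangent to the sphere. -/
structure IsEulerSolution (J : Set ℝ) (v : ℝ → S2 → E3) (p : ℝ → S2 → ℝ) : Prop where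
  smooth_velocity : IsSmoothInTime J v
  smooth_pressure : IsSmoothInTime J p
  tangent : ∀ t ∈ J, IsTangent (v t)
  momentum_eq : ∀ t ∈ J, ∀ x, deriv (fun s => v s x) t + covDeriv (v t) (v t) x = -grad (p t) x
  div_eq_zero : ∀ t ∈ J, ∀ x, div (v t) x = 0

/-- `(ω, ψ)` is a smooth solution on `J × S²` of the Euler-Arnold (vorticity) equation
`∂ₜω + {ω, ψ} = 0`, `-Δψ = ω`, where `ψ` takes values in the smooth functions of mean zero. -/
structure IsVorticitySolution (J : Set ℝ) (ω ψ : ℝ → S2 → ℝ) : Prop where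
  smooth_vorticity : IsSmoothInTime J ω
  smooth_stream : IsSmoothInTime J ψ
  mean_zero : ∀ t ∈ J, ∫ x, ψ t x ∂area = 0
  vorticity_eq : ∀ t ∈ J, ∀ x, deriv (fun s => ω s x) t + poisson (ω t) (ψ t) x = 0
  poisson_eq : ∀ t ∈ J, ∀ x, -laplacian (ψ t) x = ω t x

end

end

end SphereHydro

namespace SphereHydro

open scoped Manifold ContDiff Topology RealInnerProductSpace EuclideanSpace
open Set Filter MeasureTheory

/-! ### Radially constant extensions -/

section Radial

variable {V : Type*} [NormedAddCommGroup V] [NormedSpace ℝ V]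

/-! All calculus on the sphere is done with the radially constant extension `y ↦ F (y / |y|)` on `ℝ³
∖ {0}`. The intrinsic derivative is then a flat derivative, and symmetry of second derivatives gives
`curl ∇f = 0`. The quarter turn `x × ·` exchanges divergence and curl, so divergence-free tangent
fields correspond to curl-free ones.

The analytic core is the Lamb form `∇_v v = ∇(|v|²/2) + (curl v) x × v` (`covDeriv_self`). It shows
that the acceleration of a divergence-free `v` has curl `∂ₜω + ⟨∇ω, v⟩` with `ω = curl v`, and for
`v = ∇^⊥ψ` the last term is `{ω, ψ}` (`curl_acceleration`, `poisson_eq_inner`). Thus the curl of the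
momentum equation is the vorticity equation. Conversely, the vorticity equation says that the
acceleration is curl-free, so a pressure exists as soon as curl-free tangent fields are gradients.

That last fact (`exists_potential`) also yields the stream function, as a potential of `x × v`. It
is proved by pulling the one-form back to `ℝ³ ∖ {0}`, covering this space by two star-shaped slit
spaces with connected overlap, and gluing the two segment integrals. Differentiation under the
integral sign keeps everything smooth in time.

The momentum identity is Green's formula. It follows from the divergence theorem on the sphere,
which comes from integration by parts in `ℝ³` against a radial cutoff. Uniqueness holds because a
gradient determines a function up to a constant, which the zero mean fixes. -/

lemma norm_coe (x : S2) : ‖(x : E3)‖ = 1 := by simp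

lemma coe_ne_zero (x : S2) : (x : E3) ≠ 0 := by
  intro h
  simpa [h] using norm_coe x

lemma inner_self_coe (x : S2) : ⟪(x : E3), (x : E3)⟫ = 1 := by
  simp

omit [NormedSpace ℝ V] in
lemma radialExt_of_ne (F : S2 → V) {y : E3} (hy : y ≠ 0) : radialExt F y = F (radialProj y hy) := by
  simp [radialExt, hy]

@[simp]
lemma radialProj_coe (x : S2) (hx : (x : E3) ≠ 0) : radialProj x hx = x := by
  ext1
  simp [radialProj]

omit [NormedSpace ℝ V] in
@[simp]
lemma radialExt_coe (F : S2 → V) (x : S2) : radialExt F (x : E3) = F x := by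
  rw [radialExt_of_ne F (coe_ne_zero x), radialProj_coe]

omit [NormedSpace ℝ V] in
lemma radialExt_smul (F : S2 → V) {c : ℝ} (hc : 0 < c) (y : E3) :
    radialExt F (c • y) = radialExt F y := by
  by_cases hy : y = 0
  · simp [hy]
  · have hcy : c • y ≠ 0 := smul_ne_zero hc.ne' hy
    rw [radialExt_of_ne F hcy, radialExt_of_ne F hy]
    congr 1
    ext1
    simp only [radialProj, norm_smul, smul_smul, Real.norm_of_nonneg hc.le]
    congr 1
    field_simp

omit [NormedSpace ℝ V] in
/-- A map agreeing with `F (y / |y|)` away from the origin agrees with the radial extension of `F`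
near every nonzero point. -/
lemma radialExt_eventuallyEq {F : S2 → V} {G : E3 → V}
    (h : ∀ (y : E3) (hy : y ≠ 0), F (radialProj y hy) = G y) {y : E3} (hy : y ≠ 0) :
    radialExt F =ᶠ[𝓝 y] G := by
  filter_upwards [isOpen_ne.mem_nhds hy] with z hz
  rw [radialExt_of_ne F hz, h]

lemma isOpen_prod_compl_zero {J : Set ℝ} (hJ : IsOpen J) : IsOpen (J ×ˢ ({0}ᶜ : Set E3)) :=
  hJ.prod isOpen_compl_singleton

/-- The time-dependent radial extension of a smooth time-dependent map is smooth. -/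
lemma IsSmoothInTime.contDiffOn_radialExt {J : Set ℝ} (hJ : IsOpen J) {F : ℝ → S2 → V}
    (hF : IsSmoothInTime J F) :
    ContDiffOn ℝ ∞ (fun z : ℝ × E3 => radialExt (F z.1) z.2) (J ×ˢ {0}ᶜ) := by
  -- On the open submanifold `U` the normalisation `y / |y|` is a globally smooth map into the
  -- sphere, so it can be composed with `F`.
  let U : TopologicalSpace.Opens (ℝ × E3) := ⟨J ×ˢ {0}ᶜ, isOpen_prod_compl_zero hJ⟩
  have hU : ∀ z : U, z.1.2 ≠ 0 := fun z => z.2.2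
  have h1 : ContMDiff 𝓘(ℝ, ℝ × E3) 𝓘(ℝ, E3) ∞ (fun z : U => ‖z.1.2‖⁻¹ • z.1.2) := by
    intro z
    have : ContDiffAt ℝ ∞ (fun z : ℝ × E3 => ‖z.2‖⁻¹ • z.2) z.1 :=
      ((contDiffAt_snd.norm ℝ (hU z)).inv (norm_ne_zero_iff.2 (hU z))).smul contDiffAt_snd
    exact (contMDiffAt_subtype_iff (U := U) (f := fun z : ℝ × E3 => ‖z.2‖⁻¹ • z.2)).2
      this.contMDiffAt
  have h2 := h1.codRestrict_sphere (n := 2) (fun z => by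
    simp [norm_smul, hU z])
  have h3 : ContMDiff 𝓘(ℝ, ℝ × E3) 𝓘(ℝ, ℝ) ∞ (fun z : U => z.1.1) := by
    intro z
    exact (contMDiffAt_subtype_iff (U := U) (f := fun z : ℝ × E3 => z.1)).2
      contDiffAt_fst.contMDiffAt
  have h4 := (hF.comp_contMDiff (h3.prodMk h2) (fun z => ⟨z.2.1, mem_univ _⟩))
  intro z hz
  have h5 := h4 ⟨z, hz⟩
  have h6 := (contMDiffAt_subtype_iff (U := U) (I := 𝓘(ℝ, ℝ × E3)) (I' := 𝓘(ℝ, V)) (n := ∞)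
    (f := fun z : ℝ × E3 => radialExt (F z.1) z.2) (x := ⟨z, hz⟩)).1
    (h5.congr_of_eventuallyEq (.of_forall fun w => by
      simp only [Function.comp]
      rw [radialExt_of_ne _ (hU w)]
      rfl))
  exact h6.contDiffAt.contDiffWithinAt

/-- Restriction along `S² ⊂ ℝ³ ∖ {0}`. Together with the converse passage to the radial extension it
replaces charts by smoothness on an open subset of `ℝ × ℝ³`. -/
lemma isSmoothInTime_of_contDiffOn {J : Set ℝ} {G : ℝ × E3 → V}
    (hG : ContDiffOn ℝ ∞ G (J ×ˢ {0}ᶜ)) : IsSmoothInTime J (fun t x => G (t, x)) := by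
  have h1 : ContMDiff (𝓘(ℝ, ℝ).prod (𝓡 2)) 𝓘(ℝ, ℝ × E3) ∞
      (fun z : ℝ × S2 => ((z.1, z.2) : ℝ × E3)) :=
    contMDiff_fst.prodMk_space ((contMDiff_coe_sphere (n := 2)).comp contMDiff_snd)
  exact hG.contMDiffOn.comp h1.contMDiffOn fun z hz => ⟨hz.1, coe_ne_zero z.2⟩

/-- A map on the sphere whose radial extension is smooth away from the origin. -/
def IsRadiallySmooth (F : S2 → V) : Prop := ContDiffOn ℝ ∞ (radialExt F) {0}ᶜ

lemma IsSmoothInTime.isRadiallySmooth {J : Set ℝ} (hJ : IsOpen J) {F : ℝ → S2 → V}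
    (hF : IsSmoothInTime J F) {t : ℝ} (ht : t ∈ J) : IsRadiallySmooth (F t) :=
  (hF.contDiffOn_radialExt hJ).comp (f := fun y : E3 => (t, y))
    (contDiff_const.prodMk contDiff_id).contDiffOn fun _ hy => ⟨ht, hy⟩

lemma IsSmooth.isRadiallySmooth {f : S2 → ℝ} (hf : IsSmooth f) : IsRadiallySmooth f := by
  have : IsSmoothInTime univ (fun _ : ℝ => f) :=
    (ContMDiff.comp hf contMDiff_snd).contMDiffOn
  exact this.isRadiallySmooth isOpen_univ (mem_univ 0)

lemma IsRadiallySmooth.contDiffAt {F : S2 → V} (hF : IsRadiallySmooth F) {y : E3} (hy : y ≠ 0) :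
    ContDiffAt ℝ ∞ (radialExt F) y :=
  ContDiffOn.contDiffAt hF (isOpen_ne.mem_nhds hy)

lemma IsRadiallySmooth.differentiableAt {F : S2 → V} (hF : IsRadiallySmooth F) (x : S2) :
    DifferentiableAt ℝ (radialExt F) (x : E3) :=
  (hF.contDiffAt (coe_ne_zero x)).differentiableAt (by simp)

lemma IsRadiallySmooth.continuous {F : S2 → V} (hF : IsRadiallySmooth F) : Continuous F := by
  have : Continuous (fun x : S2 => radialExt F (x : E3)) :=
    ContDiffOn.continuousOn hF |>.comp_continuous continuous_subtype_val
      (fun x => coe_ne_zero x)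
  simpa using this

end Radial

/-! ### First order calculus on the sphere -/

section Calculus

variable {V W Z : Type*} [NormedAddCommGroup V] [NormedSpace ℝ V]
  [NormedAddCommGroup W] [NormedSpace ℝ W] [NormedAddCommGroup Z] [NormedSpace ℝ Z]

/-- The extension is homogeneous of degree `0`, hence its derivative is homogeneous of degree `-1`.
-/
lemma fderiv_radialExt_smul (F : S2 → V) {c : ℝ} (hc : 0 < c) (y : E3) :
    fderiv ℝ (radialExt F) (c • y) = c⁻¹ • fderiv ℝ (radialExt F) y := by
  have h : (fun y => radialExt F (c • y)) = radialExt F := funext (radialExt_smul F hc)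
  have h2 := fderiv_comp_smul (𝕜 := ℝ) (f := radialExt F) (x := y) c
  rw [h] at h2
  rw [h2, smul_smul, inv_mul_cancel₀ hc.ne', one_smul]

lemma fderiv_radialExt (F : S2 → V) {y : E3} (hy : y ≠ 0) :
    fderiv ℝ (radialExt F) y = ‖y‖⁻¹ • tangentDeriv F (radialProj y hy) := by
  have h := fderiv_radialExt_smul F (inv_pos.2 (norm_pos_iff.2 hy)) y
  have h2 : tangentDeriv F (radialProj y hy) = fderiv ℝ (radialExt F) (‖y‖⁻¹ • y) := rfl
  rw [h2, h, smul_smul, inv_inv, inv_mul_cancel₀ (norm_ne_zero_iff.2 hy), one_smul]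

-- The extension is constant along rays; where it is not differentiable, `fderiv` has the default
-- value `0` anyway.
@[simp]
lemma tangentDeriv_self (F : S2 → V) (x : S2) : tangentDeriv F x (x : E3) = 0 := by
  by_cases hF : DifferentiableAt ℝ (radialExt F) (x : E3)
  · have h1 : HasDerivAt (fun c : ℝ => c • (x : E3)) ((1 : ℝ) • (x : E3)) 1 :=
      (hasDerivAt_id (1 : ℝ)).smul_const _
    have h2 : HasFDerivAt (radialExt F) (tangentDeriv F x) ((1 : ℝ) • (x : E3)) := by
      rw [one_smul]; exact hF.hasFDerivAt
    have h3 := h2.comp_hasDerivAt (1 : ℝ) h1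
    have h4 : HasDerivAt (radialExt F ∘ fun c : ℝ => c • (x : E3)) 0 1 := by
      refine (hasDerivAt_const (1 : ℝ) (F x)).congr_of_eventuallyEq ?_
      filter_upwards [lt_mem_nhds (zero_lt_one (α := ℝ))] with c hc
      simp [radialExt_smul F hc]
    simpa using h3.unique h4
  · simp [tangentDeriv, fderiv_zero_of_not_differentiableAt hF]

-- The condition `B 0 0 = 0` matches the default value of the extension at the origin, so the two
-- functions agree everywhere.
omit [NormedSpace ℝ V] [NormedSpace ℝ W] [NormedSpace ℝ Z] in
lemma radialExt_comp₂ {B : V → W → Z} (hB : B 0 0 = 0) (F : S2 → V) (G : S2 → W) :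
    radialExt (fun x => B (F x) (G x)) = fun y => B (radialExt F y) (radialExt G y) := by
  ext y
  by_cases hy : y = 0 <;> simp [radialExt, hy, hB]

omit [NormedSpace ℝ V] [NormedSpace ℝ W] in
lemma radialExt_comp {B : V → W} (hB : B 0 = 0) (F : S2 → V) :
    radialExt (fun x => B (F x)) = fun y => B (radialExt F y) :=
  radialExt_comp₂ (B := fun v (_ : V) => B v) hB F F

lemma tangentDeriv_bilin (B : V →L[ℝ] W →L[ℝ] Z) {F : S2 → V} {G : S2 → W} {x : S2}
    (hF : DifferentiableAt ℝ (radialExt F) (x : E3))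
    (hG : DifferentiableAt ℝ (radialExt G) (x : E3)) (w : E3) :
    tangentDeriv (fun x => B (F x) (G x)) x w =
      B (F x) (tangentDeriv G x w) + B (tangentDeriv F x w) (G x) := by
  rw [tangentDeriv, radialExt_comp₂ (B := fun v w => B v w) (by simp),
    (B.hasFDerivAt_of_bilinear hF.hasFDerivAt hG.hasFDerivAt).fderiv]
  simp [tangentDeriv]

lemma tangentDeriv_clm (L : V →L[ℝ] W) {F : S2 → V} {x : S2}
    (hF : DifferentiableAt ℝ (radialExt F) (x : E3)) :
    tangentDeriv (fun x => L (F x)) x = L ∘L tangentDeriv F x := by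
  rw [tangentDeriv, radialExt_comp (B := fun v => L v) (by simp)]
  exact (L.hasFDerivAt.comp (x : E3) hF.hasFDerivAt).fderiv

lemma tangentDeriv_add {F G : S2 → V} {x : S2} (hF : DifferentiableAt ℝ (radialExt F) (x : E3))
    (hG : DifferentiableAt ℝ (radialExt G) (x : E3)) :
    tangentDeriv (fun x => F x + G x) x = tangentDeriv F x + tangentDeriv G x := by
  rw [tangentDeriv, radialExt_comp₂ (B := fun v w => v + w) (by simp)]
  exact (hF.hasFDerivAt.add hG.hasFDerivAt).fderiv

lemma tangentDeriv_neg (F : S2 → V) (x : S2) :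
    tangentDeriv (fun x => -F x) x = -tangentDeriv F x := by
  rw [tangentDeriv, radialExt_comp (B := fun v => -v) (by simp), fderiv_fun_neg]
  rfl

lemma radialExt_coe_eventuallyEq {y : E3} (hy : y ≠ 0) :
    radialExt (fun x : S2 => (x : E3)) =ᶠ[𝓝 y] fun y => ‖y‖⁻¹ • y :=
  radialExt_eventuallyEq (fun _ _ => rfl) hy

/-- The Euclidean inner product as a continuous bilinear map. -/
noncomputable def dotCLM : E3 →L[ℝ] E3 →L[ℝ] ℝ := innerSL ℝ

@[simp]
lemma dotCLM_apply (a b : E3) : dotCLM a b = ⟪a, b⟫ := rfl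

lemma hasFDerivAt_norm_coe (x : S2) :
    HasFDerivAt (fun y : E3 => ‖y‖) (dotCLM (x : E3)) (x : E3) := by
  have h := (hasStrictFDerivAt_norm_sq (x : E3)).hasFDerivAt.sqrt (by simp)
  simp only [Real.sqrt_sq (norm_nonneg _), norm_coe] at h
  refine h.congr_fderiv ?_
  ext w
  simp [innerSL_apply_apply]

lemma tangentProj_apply (x : S2) (w : E3) : tangentProj x w = w - ⟪(x : E3), w⟫ • (x : E3) := by
  simp [tangentProj]

lemma hasFDerivAt_radialExt_coe (x : S2) :
    HasFDerivAt (radialExt fun x : S2 => (x : E3)) (tangentProj x) (x : E3) := by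
  have h1 := (hasDerivAt_inv (x := ‖(x : E3)‖) (by simp)).comp_hasFDerivAt (x : E3)
    (hasFDerivAt_norm_coe x)
  have h2 := (h1.smul (hasFDerivAt_id (x : E3))).congr_of_eventuallyEq
    (radialExt_coe_eventuallyEq (coe_ne_zero x))
  refine h2.congr_fderiv ?_
  ext1 w
  simp [tangentProj_apply, sub_eq_add_neg]

lemma tangentDeriv_coe (x : S2) : tangentDeriv (fun x : S2 => (x : E3)) x = tangentProj x :=
  (hasFDerivAt_radialExt_coe x).fderiv

/-! ### The cross product -/

/-- The cross product as a continuous bilinear map. -/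
noncomputable def crossCLM : E3 →L[ℝ] E3 →L[ℝ] E3 :=
  LinearMap.toContinuousBilinearMap <|
    LinearMap.mk₂ ℝ cross (by intros; ext i; simp [cross])
      (by intros; ext i; simp [cross]) (by intros; ext i; simp [cross])
      (by intros; ext i; simp [cross])

@[simp]
lemma crossCLM_apply (a b : E3) : crossCLM a b = cross a b := rfl

@[simp] lemma cross_zero_coord (a b : E3) : cross a b 0 = a 1 * b 2 - a 2 * b 1 := by
  simp [cross, cross_apply]

@[simp] lemma cross_one_coord (a b : E3) : cross a b 1 = a 2 * b 0 - a 0 * b 2 := by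
  simp [cross, cross_apply]

@[simp] lemma cross_two_coord (a b : E3) : cross a b 2 = a 0 * b 1 - a 1 * b 0 := by
  simp [cross, cross_apply]

lemma ext3 {a b : E3} (h0 : a 0 = b 0) (h1 : a 1 = b 1) (h2 : a 2 = b 2) : a = b := by
  ext i
  fin_cases i <;> assumption

lemma inner_eq_sum3 (a b : E3) : ⟪a, b⟫ = a 0 * b 0 + a 1 * b 1 + a 2 * b 2 := by
  simp [PiLp.inner_apply, Fin.sum_univ_three]
  ring

lemma sum_sq_coe (x : S2) :
    (x : E3) 0 * (x : E3) 0 + (x : E3) 1 * (x : E3) 1 + (x : E3) 2 * (x : E3) 2 = 1 := by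
  rw [← inner_eq_sum3, inner_self_coe]

lemma neg_cross (a b : E3) : -cross a b = cross b a := by
  apply ext3 <;> simp <;> ring

/-- On tangent vectors `x × ·` and `· × x` are mutually inverse quarter turns; this is what
exchanges divergence and curl. -/
lemma cross_cross_coe (x : S2) (a : E3) :
    cross (cross (x : E3) a) (x : E3) = a - ⟪(x : E3), a⟫ • (x : E3) := by
  have h := sum_sq_coe x
  apply ext3 <;> simp [inner_eq_sum3]
  · linear_combination (a 0) * h
  · linear_combination (a 1) * h
  · linear_combination (a 2) * h

/-! ### Coordinates -/

/-- The standard basis vectors of `ℝ³`. -/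
noncomputable def stdVec (i : Fin 3) : E3 := EuclideanSpace.single i 1

lemma stdVec_apply (i j : Fin 3) : stdVec i j = if j = i then 1 else 0 := by
  simp [stdVec]

lemma trace_eq_sum3 (L : E3 →ₗ[ℝ] E3) :
    LinearMap.trace ℝ E3 L = L (stdVec 0) 0 + L (stdVec 1) 1 + L (stdVec 2) 2 := by
  rw [LinearMap.trace_eq_sum_inner L (EuclideanSpace.basisFun (Fin 3) ℝ), Fin.sum_univ_three]
  simp [EuclideanSpace.inner_single_left, stdVec]

lemma eq_sum_stdVec (w : E3) : w = w 0 • stdVec 0 + w 1 • stdVec 1 + w 2 • stdVec 2 := by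
  apply ext3 <;> simp [stdVec_apply]

lemma map_eq_sum3 (L : E3 →L[ℝ] V) (w : E3) :
    L w = w 0 • L (stdVec 0) + w 1 • L (stdVec 1) + w 2 • L (stdVec 2) := by
  conv_lhs => rw [eq_sum_stdVec w]
  simp

lemma sum_coe_smul_tangentDeriv (F : S2 → V) (x : S2) :
    (x : E3) 0 • tangentDeriv F x (stdVec 0) + (x : E3) 1 • tangentDeriv F x (stdVec 1) +
      (x : E3) 2 • tangentDeriv F x (stdVec 2) = 0 := by
  rw [← map_eq_sum3, tangentDeriv_self]

/-- The divergence is the trace of the flat derivative of the radially constant extension. -/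
lemma div_eq_sum (v : S2 → E3) (x : S2) :
    div v x = tangentDeriv v x (stdVec 0) 0 + tangentDeriv v x (stdVec 1) 1 +
      tangentDeriv v x (stdVec 2) 2 := by
  -- The tangential projection lowers the trace by `⟨x, Dv(x)⟩`, which vanishes because the radial
  -- derivative does.
  have h := sum_coe_smul_tangentDeriv v x
  have h0 := congrArg (fun a : E3 => a 0) h
  have h1 := congrArg (fun a : E3 => a 1) h
  have h2 := congrArg (fun a : E3 => a 2) h
  simp at h0 h1 h2
  rw [div, trace_eq_sum3]
  simp [covDiff, tangentProj_apply, inner_eq_sum3]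
  linear_combination (-(x : E3) 0) * h0 - (x : E3) 1 * h1 - (x : E3) 2 * h2

/-- The scalar curl is the normal component of the flat curl of the radially constant extension. -/
lemma curl_eq_sum {v : S2 → E3} {x : S2} (hv : DifferentiableAt ℝ (radialExt v) (x : E3)) :
    curl v x =
      (x : E3) 0 * (tangentDeriv v x (stdVec 1) 2 - tangentDeriv v x (stdVec 2) 1) +
      (x : E3) 1 * (tangentDeriv v x (stdVec 2) 0 - tangentDeriv v x (stdVec 0) 2) +
      (x : E3) 2 * (tangentDeriv v x (stdVec 0) 1 - tangentDeriv v x (stdVec 1) 0) := by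
  -- In the product rule for `v × x`, differentiating the factor `x` contributes nothing: the map `w
  -- ↦ v × Pw`, with `P` the tangential projection, has trace zero.
  have h := tangentDeriv_bilin crossCLM hv (hasFDerivAt_radialExt_coe x).differentiableAt
  simp only [crossCLM_apply, tangentDeriv_coe] at h
  rw [curl, div_eq_sum]
  simp only [h]
  simp [tangentProj_apply, inner_eq_sum3, stdVec_apply]
  ring

/-! ### The gradient -/

/-- The Riesz isomorphism in coordinates, as a continuous linear map. -/
noncomputable def dualVec : (E3 →L[ℝ] ℝ) →L[ℝ] E3 :=
  ∑ i : Fin 3, (ContinuousLinearMap.apply ℝ ℝ (stdVec i)).smulRight (stdVec i)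

lemma dualVec_apply_coord (φ : E3 →L[ℝ] ℝ) (i : Fin 3) : dualVec φ i = φ (stdVec i) := by
  fin_cases i <;> simp [dualVec, Fin.sum_univ_three, stdVec_apply]

lemma inner_dualVec (φ : E3 →L[ℝ] ℝ) (w : E3) : ⟪dualVec φ, w⟫ = φ w := by
  rw [inner_eq_sum3, map_eq_sum3 φ w]
  simp [dualVec_apply_coord]
  ring

@[simp]
lemma inner_grad (f : S2 → ℝ) (x : S2) (w : E3) : ⟪grad f x, w⟫ = tangentDeriv f x w := by
  simp [grad]

lemma grad_eq_dualVec (f : S2 → ℝ) : grad f = fun x => dualVec (tangentDeriv f x) := by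
  ext1 x
  refine ext_inner_right ℝ fun w => ?_
  rw [inner_grad, inner_dualVec]

lemma grad_coord (f : S2 → ℝ) (x : S2) (i : Fin 3) : grad f x i = tangentDeriv f x (stdVec i) := by
  rw [grad_eq_dualVec, dualVec_apply_coord]

lemma inner_coe_grad (f : S2 → ℝ) (x : S2) : ⟪(x : E3), grad f x⟫ = 0 := by
  rw [real_inner_comm, inner_grad, tangentDeriv_self]

/-- The extension of `tangentDeriv F` has degree `0` and the flat derivative has degree `-1`, so
they differ by the factor `|y|`. Differentiating this factor produces the second summand. -/
lemma hasFDerivAt_radialExt_tangentDeriv {F : S2 → V} (hF : IsRadiallySmooth F) (x : S2) :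
    HasFDerivAt (radialExt (tangentDeriv F))
      (fderiv ℝ (fderiv ℝ (radialExt F)) (x : E3) +
        (dotCLM (x : E3)).smulRight (tangentDeriv F x)) (x : E3) := by
  have h1 : radialExt (tangentDeriv F) =ᶠ[𝓝 (x : E3)]
      fun y => ‖y‖ • fderiv ℝ (radialExt F) y :=
    radialExt_eventuallyEq (fun y hy => by
      rw [fderiv_radialExt F hy, smul_smul, mul_inv_cancel₀ (norm_ne_zero_iff.2 hy), one_smul])
      (coe_ne_zero x)
  have h2 : DifferentiableAt ℝ (fderiv ℝ (radialExt F)) (x : E3) :=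
    ((hF.contDiffAt (coe_ne_zero x)).fderiv_right (m := 1) (by norm_cast)).differentiableAt (by simp)
  have h3 := ((hasFDerivAt_norm_coe x).smul h2.hasFDerivAt).congr_of_eventuallyEq h1
  refine h3.congr_fderiv ?_
  rw [norm_coe, one_smul]
  rfl

/-- Symmetry of the flat second derivative, after removal of the summand coming from the factor
`|y|`. -/
lemma tangentDeriv_tangentDeriv_swap {F : S2 → V} (hF : IsRadiallySmooth F) (x : S2) (u w : E3) :
    tangentDeriv (tangentDeriv F) x u w - ⟪(x : E3), u⟫ • tangentDeriv F x w =
      tangentDeriv (tangentDeriv F) x w u - ⟪(x : E3), w⟫ • tangentDeriv F x u := by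
  have h := (hasFDerivAt_radialExt_tangentDeriv hF x).fderiv
  rw [← tangentDeriv] at h
  have h2 := ((hF.contDiffAt (coe_ne_zero x)).isSymmSndFDerivAt (by simp; norm_cast)).eq u w
  simp [h, h2]

lemma IsRadiallySmooth.differentiableAt_tangentDeriv {F : S2 → V} (hF : IsRadiallySmooth F)
    (x : S2) : DifferentiableAt ℝ (radialExt (tangentDeriv F)) (x : E3) :=
  (hasFDerivAt_radialExt_tangentDeriv hF x).differentiableAt

lemma differentiableAt_radialExt_clm (L : V →L[ℝ] W) {F : S2 → V} {x : S2}
    (hF : DifferentiableAt ℝ (radialExt F) (x : E3)) :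
    DifferentiableAt ℝ (radialExt fun x => L (F x)) (x : E3) := by
  rw [radialExt_comp (B := fun v => L v) (by simp)]
  exact L.differentiableAt.comp (x : E3) hF

lemma IsRadiallySmooth.differentiableAt_grad {f : S2 → ℝ} (hf : IsRadiallySmooth f)
    (x : S2) : DifferentiableAt ℝ (radialExt (grad f)) (x : E3) := by
  rw [grad_eq_dualVec]
  exact differentiableAt_radialExt_clm dualVec (hf.differentiableAt_tangentDeriv x)

lemma tangentDeriv_grad_coord {f : S2 → ℝ} (hf : IsRadiallySmooth f) (x : S2) (w : E3)
    (i : Fin 3) :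
    tangentDeriv (grad f) x w i = tangentDeriv (tangentDeriv f) x w (stdVec i) := by
  rw [grad_eq_dualVec, tangentDeriv_clm dualVec (hf.differentiableAt_tangentDeriv x)]
  simp [dualVec_apply_coord]

/-! ### Identities of vector calculus -/

/-- The second derivatives cancel in pairs, and the correction terms add up to `x · (x × ∇f) = 0`.
-/
lemma curl_grad {f : S2 → ℝ} (hf : IsRadiallySmooth f) (x : S2) : curl (grad f) x = 0 := by
  rw [curl_eq_sum (hf.differentiableAt_grad x)]
  simp only [tangentDeriv_grad_coord hf]
  have h := fun i j => tangentDeriv_tangentDeriv_swap hf x (stdVec i) (stdVec j)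
  have h01 := h 0 1
  have h12 := h 1 2
  have h20 := h 2 0
  simp [inner_eq_sum3, stdVec_apply] at h01 h12 h20
  linear_combination (x : E3) 0 * h12 + (x : E3) 1 * h20 + (x : E3) 2 * h01

lemma skewGrad_eq_cross (ψ : S2 → ℝ) (x : S2) : skewGrad ψ x = cross (grad ψ x) (x : E3) := by
  rw [skewGrad, neg_cross]

lemma isTangent_skewGrad (ψ : S2 → ℝ) : IsTangent (skewGrad ψ) := by
  intro x
  rw [skewGrad_eq_cross]
  simp [inner_eq_sum3]
  ring

/-- Since `∇^⊥ψ = ∇ψ × x`, this divergence is by definition `curl ∇ψ`. -/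
lemma div_skewGrad {ψ : S2 → ℝ} (hψ : IsRadiallySmooth ψ) (x : S2) : div (skewGrad ψ) x = 0 := by
  rw [funext (skewGrad_eq_cross ψ)]
  exact curl_grad hψ x

lemma div_neg (v : S2 → E3) (x : S2) : div (fun x => -v x) x = -div v x := by
  simp only [div_eq_sum, tangentDeriv_neg]
  simp
  ring

/-- Two quarter turns reverse a tangent vector: `(∇ψ × x) × x = -∇ψ`. -/
lemma curl_skewGrad (ψ : S2 → ℝ) (x : S2) : curl (skewGrad ψ) x = -laplacian ψ x := by
  have h : (fun x => cross (skewGrad ψ x) (x : E3)) = fun x => -grad ψ x := by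
    ext1 x
    have := cross_cross_coe x (grad ψ x)
    rw [inner_coe_grad, zero_smul, sub_zero] at this
    rw [skewGrad_eq_cross, ← neg_cross (x : E3) (grad ψ x), ← this, this]
    nth_rw 2 [← this]
    apply ext3 <;> simp <;> ring
  rw [curl, h, div_neg, laplacian]

lemma curl_add {v w : S2 → E3} {x : S2} (hv : DifferentiableAt ℝ (radialExt v) (x : E3))
    (hw : DifferentiableAt ℝ (radialExt w) (x : E3)) :
    curl (fun x => v x + w x) x = curl v x + curl w x := by
  have h : DifferentiableAt ℝ (radialExt fun x => v x + w x) (x : E3) := by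
    rw [radialExt_comp₂ (B := fun v w => v + w) (by simp)]
    exact hv.add hw
  rw [curl_eq_sum hv, curl_eq_sum hw, curl_eq_sum h, tangentDeriv_add hv hw]
  simp
  ring

lemma curl_neg {v : S2 → E3} {x : S2} (hv : DifferentiableAt ℝ (radialExt v) (x : E3)) :
    curl (fun x => -v x) x = -curl v x := by
  have h : DifferentiableAt ℝ (radialExt fun x => -v x) (x : E3) := by
    rw [radialExt_comp (B := fun v => -v) (by simp)]
    exact hv.neg
  rw [curl_eq_sum hv, curl_eq_sum h, tangentDeriv_neg]
  simp
  ring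

lemma div_smul {f : S2 → ℝ} {v : S2 → E3} {x : S2}
    (hf : DifferentiableAt ℝ (radialExt f) (x : E3))
    (hv : DifferentiableAt ℝ (radialExt v) (x : E3)) :
    div (fun x => f x • v x) x = ⟪grad f x, v x⟫ + f x * div v x := by
  have h := tangentDeriv_bilin (ContinuousLinearMap.lsmul ℝ ℝ) hf hv
  simp only [ContinuousLinearMap.lsmul_apply] at h
  simp only [div_eq_sum, h, inner_eq_sum3, grad_coord]
  simp
  ring

/-- Differentiate `⟨x, v⟩ = 0`; this is the second fundamental form of the unit sphere. -/
lemma inner_coe_tangentDeriv {v : S2 → E3} {x : S2}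
    (hv : DifferentiableAt ℝ (radialExt v) (x : E3)) (hvt : IsTangent v) (w : E3) :
    ⟪(x : E3), tangentDeriv v x w⟫ = -⟪w, v x⟫ := by
  have h := tangentDeriv_bilin dotCLM (hasFDerivAt_radialExt_coe x).differentiableAt hv w
  have h2 : (fun x : S2 => dotCLM (x : E3) (v x)) = fun _ : S2 => (0 : ℝ) := by
    ext x
    simpa using hvt x
  have h3 : tangentDeriv (fun _ : S2 => (0 : ℝ)) x = 0 := by
    rw [tangentDeriv, radialExt_comp (B := fun _ : ℝ => (0 : ℝ)) rfl (fun _ : S2 => (0 : ℝ))]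
    simp
  rw [h2, h3, tangentDeriv_coe] at h
  simp [tangentProj_apply, hvt x] at h
  linarith

/-- The Lamb form of the convective derivative. -/
lemma covDeriv_self {v : S2 → E3} {x : S2}
    (hv : DifferentiableAt ℝ (radialExt v) (x : E3)) (hvt : IsTangent v) :
    covDeriv v v x =
      grad (fun x => 2⁻¹ * ⟪v x, v x⟫) x + curl v x • cross (x : E3) (v x) := by
  have hg : ∀ w, tangentDeriv (fun x => 2⁻¹ * ⟪v x, v x⟫) x w = ⟪v x, tangentDeriv v x w⟫ := by
    intro w
    have h := tangentDeriv_bilin ((2⁻¹ : ℝ) • dotCLM) hv hv w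
    simp only [smul_apply, dotCLM_apply, smul_eq_mul] at h
    rw [h, real_inner_comm (v x)]
    ring
  have hn := fun i => inner_coe_tangentDeriv hv hvt (stdVec i)
  have hs := sum_coe_smul_tangentDeriv v x
  have hs0 := congrArg (fun a : E3 => a 0) hs
  have hs1 := congrArg (fun a : E3 => a 1) hs
  have hs2 := congrArg (fun a : E3 => a 2) hs
  have hx := sum_sq_coe x
  have ht := hvt x
  have hn0 := hn 0
  have hn1 := hn 1
  have hn2 := hn 2
  have hg' : ∀ i, grad (fun x => 2⁻¹ * ⟪v x, v x⟫) x i =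
      v x 0 * tangentDeriv v x (stdVec i) 0 + v x 1 * tangentDeriv v x (stdVec i) 1 +
        v x 2 * tangentDeriv v x (stdVec i) 2 := fun i => by
    rw [grad_coord, hg, inner_eq_sum3]
  rw [curl_eq_sum hv]
  simp [inner_eq_sum3, stdVec_apply] at hn0 hn1 hn2 hs0 hs1 hs2 ht
  -- The normal part of `D_v v` is `-|v|² x`, so `∇_v v = D_v v + |v|² x`.
  have hL : covDeriv v v x = v x 0 • tangentDeriv v x (stdVec 0) +
      v x 1 • tangentDeriv v x (stdVec 1) + v x 2 • tangentDeriv v x (stdVec 2) +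
      (v x 0 * v x 0 + v x 1 * v x 1 + v x 2 * v x 2) • (x : E3) := by
    have hi : ⟪(x : E3), tangentDeriv v x (v x)⟫ =
        -(v x 0 * v x 0 + v x 1 * v x 1 + v x 2 * v x 2) := by
      rw [inner_coe_tangentDeriv hv hvt, inner_eq_sum3]
    simp only [covDeriv, covDiff, ContinuousLinearMap.comp_apply]
    rw [tangentProj_apply, hi, ← map_eq_sum3, neg_smul, sub_neg_eq_add]
  rw [hL]
  generalize grad (fun x => 2⁻¹ * ⟪v x, v x⟫) x = g at hg' ⊢
  have hg0 := hg' 0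
  have hg1 := hg' 1
  have hg2 := hg' 2
  clear hL hg hg' hs hn hvt
  generalize tangentDeriv v x (stdVec 0) = A at *
  generalize tangentDeriv v x (stdVec 1) = B at *
  generalize tangentDeriv v x (stdVec 2) = C at *
  generalize v x = a at *
  generalize (x : E3) = y at *
  -- `c` is the flat curl of the extension. Vanishing radial derivative and tangency give `c × x =
  -- v`, hence `c = ⟨x, c⟩ x + x × v`. Inserted into the flat identity `D_v v = ∇(|v|²/2) + c × v`,
  -- the part `(x × v) × v = -|v|² x` cancels the normal correction.
  obtain ⟨c0, hc0⟩ : ∃ c, c = B 2 - C 1 := ⟨_, rfl⟩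
  obtain ⟨c1, hc1⟩ : ∃ c, c = C 0 - A 2 := ⟨_, rfl⟩
  obtain ⟨c2, hc2⟩ : ∃ c, c = A 1 - B 0 := ⟨_, rfl⟩
  rw [← hc0, ← hc1, ← hc2]
  have e0 : c1 * y 2 - c2 * y 1 = a 0 := by
    rw [hc1, hc2]; linear_combination hs0 - hn0
  have e1 : c2 * y 0 - c0 * y 2 = a 1 := by
    rw [hc0, hc2]; linear_combination hs1 - hn1
  have e2 : c0 * y 1 - c1 * y 0 = a 2 := by
    rw [hc0, hc1]; linear_combination hs2 - hn2
  have k0 : c0 = (y 0 * c0 + y 1 * c1 + y 2 * c2) * y 0 + (y 1 * a 2 - y 2 * a 1) := by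
    linear_combination y 1 * e2 - y 2 * e1 - c0 * hx
  have k1 : c1 = (y 0 * c0 + y 1 * c1 + y 2 * c2) * y 1 + (y 2 * a 0 - y 0 * a 2) := by
    linear_combination y 2 * e0 - y 0 * e2 - c1 * hx
  have k2 : c2 = (y 0 * c0 + y 1 * c1 + y 2 * c2) * y 2 + (y 0 * a 1 - y 1 * a 0) := by
    linear_combination y 0 * e1 - y 1 * e0 - c2 * hx
  apply ext3 <;> simp
  · linear_combination -hg0 + a 2 * k1 - a 1 * k2 + a 0 * ht - a 2 * hc1 + a 1 * hc2
  · linear_combination -hg1 + a 0 * k2 - a 2 * k0 + a 1 * ht - a 0 * hc2 + a 2 * hc0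
  · linear_combination -hg2 + a 1 * k0 - a 0 * k1 + a 2 * ht - a 1 * hc0 + a 0 * hc1

/-- The Poisson bracket is the derivative along the Hamiltonian vector field. -/
lemma poisson_eq_inner (f ψ : S2 → ℝ) (x : S2) : poisson f ψ x = ⟪grad f x, skewGrad ψ x⟫ := by
  rw [skewGrad_eq_cross, poisson]
  simp [inner_eq_sum3]
  ring

/-- As `(x × v) × x = v`, the curl becomes the divergence of `f v`. -/
lemma curl_smul_cross {f : S2 → ℝ} {v : S2 → E3} {x : S2}
    (hf : DifferentiableAt ℝ (radialExt f) (x : E3))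
    (hv : DifferentiableAt ℝ (radialExt v) (x : E3)) (hvt : IsTangent v) :
    curl (fun x => f x • cross (x : E3) (v x)) x = ⟪grad f x, v x⟫ + f x * div v x := by
  have h : (fun x : S2 => cross (f x • cross (x : E3) (v x)) (x : E3)) = fun x => f x • v x := by
    ext1 x
    have h1 := cross_cross_coe x (v x)
    rw [hvt x, zero_smul, sub_zero] at h1
    rw [← crossCLM_apply, map_smul, smul_apply, crossCLM_apply, h1]
  rw [curl, h, div_smul hf hv]

end Calculus

/-! ### Smooth dependence on time -/

section Time

variable {V W Z : Type*} [NormedAddCommGroup V] [NormedSpace ℝ V]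
  [NormedAddCommGroup W] [NormedSpace ℝ W] [NormedAddCommGroup Z] [NormedSpace ℝ Z]
  {J : Set ℝ}

lemma IsSmoothInTime.congr {F G : ℝ → S2 → V} (hF : IsSmoothInTime J F)
    (h : ∀ t ∈ J, ∀ x, G t x = F t x) : IsSmoothInTime J G :=
  ContMDiffOn.congr hF fun z hz => h z.1 hz.1 z.2

lemma IsSmoothInTime.contDiff_comp {g : V → W} (hg : ContDiff ℝ ∞ g) {F : ℝ → S2 → V}
    (hF : IsSmoothInTime J F) : IsSmoothInTime J (fun t x => g (F t x)) :=
  hg.contMDiff.comp_contMDiffOn hF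

lemma IsSmoothInTime.prodMk {F : ℝ → S2 → V} {G : ℝ → S2 → W}
    (hF : IsSmoothInTime J F) (hG : IsSmoothInTime J G) :
    IsSmoothInTime J (fun t x => (F t x, G t x)) :=
  ContMDiffOn.prodMk_space hF hG

lemma IsSmoothInTime.clm (L : V →L[ℝ] W) {F : ℝ → S2 → V} (hF : IsSmoothInTime J F) :
    IsSmoothInTime J (fun t x => L (F t x)) :=
  hF.contDiff_comp L.contDiff

lemma IsSmoothInTime.bilin (B : V →L[ℝ] W →L[ℝ] Z) {F : ℝ → S2 → V} {G : ℝ → S2 → W}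
    (hF : IsSmoothInTime J F) (hG : IsSmoothInTime J G) :
    IsSmoothInTime J (fun t x => B (F t x) (G t x)) :=
  (hF.prodMk hG).contDiff_comp B.isBoundedBilinearMap.contDiff

lemma IsSmoothInTime.add {F G : ℝ → S2 → V} (hF : IsSmoothInTime J F) (hG : IsSmoothInTime J G) :
    IsSmoothInTime J (fun t x => F t x + G t x) :=
  (hF.prodMk hG).contDiff_comp contDiff_add

lemma IsSmoothInTime.sub {F G : ℝ → S2 → V} (hF : IsSmoothInTime J F) (hG : IsSmoothInTime J G) :
    IsSmoothInTime J (fun t x => F t x - G t x) :=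
  (hF.prodMk hG).contDiff_comp (contDiff_fst.sub contDiff_snd)

lemma IsSmoothInTime.neg {F : ℝ → S2 → V} (hF : IsSmoothInTime J F) :
    IsSmoothInTime J (fun t x => -F t x) :=
  hF.contDiff_comp contDiff_neg

lemma isSmoothInTime_coe : IsSmoothInTime J (fun _ x => (x : E3)) :=
  isSmoothInTime_of_contDiffOn (G := fun z => z.2) contDiffOn_snd

lemma isSmoothInTime_of_contDiffOn_time {c : ℝ → V} (hc : ContDiffOn ℝ ∞ c J) :
    IsSmoothInTime J (fun t _ => c t) :=
  isSmoothInTime_of_contDiffOn (G := fun z => c z.1)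
    (hc.comp contDiffOn_fst fun _ hz => hz.1)

/-- The joint radially constant extension of a time-dependent map. -/
noncomputable def timeExt (F : ℝ → S2 → V) (z : ℝ × E3) : V := radialExt (F z.1) z.2

lemma IsSmoothInTime.contDiffAt_timeExt (hJ : IsOpen J) {F : ℝ → S2 → V}
    (hF : IsSmoothInTime J F) {t : ℝ} (ht : t ∈ J) {y : E3} (hy : y ≠ 0) :
    ContDiffAt ℝ ∞ (timeExt F) (t, y) :=
  (hF.contDiffOn_radialExt hJ).contDiffAt ((isOpen_prod_compl_zero hJ).mem_nhds ⟨ht, hy⟩)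

lemma IsSmoothInTime.hasFDerivAt_radialExt (hJ : IsOpen J) {F : ℝ → S2 → V}
    (hF : IsSmoothInTime J F) {t : ℝ} (ht : t ∈ J) {y : E3} (hy : y ≠ 0) :
    HasFDerivAt (radialExt (F t))
      ((fderiv ℝ (timeExt F) (t, y)).comp (ContinuousLinearMap.inr ℝ ℝ E3)) y :=
  ((hF.contDiffAt_timeExt hJ ht hy).differentiableAt (by simp)).hasFDerivAt.comp y
    (hasFDerivAt_prodMk_right t y)

lemma IsSmoothInTime.hasDerivAt_radialExt (hJ : IsOpen J) {F : ℝ → S2 → V}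
    (hF : IsSmoothInTime J F) {t : ℝ} (ht : t ∈ J) {y : E3} (hy : y ≠ 0) :
    HasDerivAt (fun s => radialExt (F s) y) (fderiv ℝ (timeExt F) (t, y) (1, 0)) t := by
  have h := ((hF.contDiffAt_timeExt hJ ht hy).differentiableAt
    (by simp)).hasFDerivAt.comp_hasDerivAt t
    ((hasDerivAt_id t).prodMk (hasDerivAt_const t y))
  exact h

lemma IsSmoothInTime.contDiffOn_fderiv_timeExt (hJ : IsOpen J) {F : ℝ → S2 → V}
    (hF : IsSmoothInTime J F) : ContDiffOn ℝ ∞ (fderiv ℝ (timeExt F)) (J ×ˢ {0}ᶜ) :=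
  (hF.contDiffOn_radialExt hJ).fderiv_of_isOpen (isOpen_prod_compl_zero hJ) (by simp)

lemma IsSmoothInTime.tangentDeriv (hJ : IsOpen J) {F : ℝ → S2 → V} (hF : IsSmoothInTime J F) :
    IsSmoothInTime J (fun t x => tangentDeriv (F t) x) :=
  (isSmoothInTime_of_contDiffOn
    ((hF.contDiffOn_fderiv_timeExt hJ).clm_comp contDiffOn_const)).congr
    fun _ ht x => (hF.hasFDerivAt_radialExt hJ ht (coe_ne_zero x)).fderiv

lemma IsSmoothInTime.hasDerivAt (hJ : IsOpen J) {F : ℝ → S2 → V} (hF : IsSmoothInTime J F)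
    {t : ℝ} (ht : t ∈ J) (x : S2) :
    HasDerivAt (fun s => F s x) (fderiv ℝ (timeExt F) (t, (x : E3)) (1, 0)) t := by
  simpa using hF.hasDerivAt_radialExt hJ ht (coe_ne_zero x)

lemma IsSmoothInTime.timeDeriv (hJ : IsOpen J) {F : ℝ → S2 → V} (hF : IsSmoothInTime J F) :
    IsSmoothInTime J (fun t x => deriv (fun s => F s x) t) :=
  (isSmoothInTime_of_contDiffOn
    ((hF.contDiffOn_fderiv_timeExt hJ).clm_apply contDiffOn_const)).congr
    fun _ ht x => (hF.hasDerivAt hJ ht x).deriv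

/-- Time and space derivatives commute. -/
lemma IsSmoothInTime.hasDerivAt_tangentDeriv (hJ : IsOpen J) {F : ℝ → S2 → V}
    (hF : IsSmoothInTime J F) {t : ℝ} (ht : t ∈ J) (x : S2) (w : E3) :
    HasDerivAt (fun s => SphereHydro.tangentDeriv (F s) x w)
      (SphereHydro.tangentDeriv (fun x => deriv (fun s => F s x) t) x w) t := by
  have hmem := (isOpen_prod_compl_zero hJ).mem_nhds
    (show (t, (x : E3)) ∈ J ×ˢ ({0}ᶜ : Set E3) from ⟨ht, coe_ne_zero x⟩)
  have hD : HasFDerivAt (fderiv ℝ (timeExt F)) (fderiv ℝ (fderiv ℝ (timeExt F)) (t, (x : E3)))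
      (t, (x : E3)) :=
    (((hF.contDiffOn_fderiv_timeExt hJ).contDiffAt hmem).differentiableAt (by simp)).hasFDerivAt
  -- Symmetry of the joint second derivative on `ℝ × ℝ³`, for the time direction `(1, 0)` and the
  -- space direction `(0, w)`.
  have hsymm := ((hF.contDiffAt_timeExt hJ ht (coe_ne_zero x)).isSymmSndFDerivAt
    (by simp; norm_cast)).eq (1, 0) (0, w)
  have h1 : HasDerivAt (fun s => fderiv ℝ (timeExt F) (s, (x : E3)) (0, w))
      (fderiv ℝ (fderiv ℝ (timeExt F)) (t, (x : E3)) (1, 0) (0, w)) t :=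
    (ContinuousLinearMap.apply ℝ V ((0, w) : ℝ × E3)).hasFDerivAt.comp_hasDerivAt t
      (hD.comp_hasDerivAt t ((hasDerivAt_id t).prodMk (hasDerivAt_const t (x : E3))))
  have h2 : HasFDerivAt (fun y : E3 => fderiv ℝ (timeExt F) (t, y) (1, 0))
      ((ContinuousLinearMap.apply ℝ V ((1, 0) : ℝ × E3)).comp
        ((fderiv ℝ (fderiv ℝ (timeExt F)) (t, (x : E3))).comp
          (ContinuousLinearMap.inr ℝ ℝ E3))) (x : E3) :=
    (ContinuousLinearMap.apply ℝ V ((1, 0) : ℝ × E3)).hasFDerivAt.comp (x : E3)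
      (hD.comp (x : E3) (hasFDerivAt_prodMk_right t (x : E3)))
  have h3 : radialExt (fun x => deriv (fun s => F s x) t) =ᶠ[𝓝 (x : E3)]
      fun y => fderiv ℝ (timeExt F) (t, y) (1, 0) :=
    radialExt_eventuallyEq (fun y hy => by
      rw [← (hF.hasDerivAt_radialExt hJ ht hy).deriv]
      simp only [radialExt_of_ne _ hy]) (coe_ne_zero x)
  have h4 := (h2.congr_of_eventuallyEq h3).fderiv
  rw [← SphereHydro.tangentDeriv] at h4
  rw [h4]
  have h5 := h1.congr_of_eventuallyEq (f₁ := fun s => SphereHydro.tangentDeriv (F s) x w) (by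
    filter_upwards [hJ.mem_nhds ht] with s hs
    rw [SphereHydro.tangentDeriv, (hF.hasFDerivAt_radialExt hJ hs (coe_ne_zero x)).fderiv]
    simp)
  rw [hsymm] at h5
  exact h5

/-! ### Smoothness of the differential operators -/

/-- The trace as a continuous linear functional. -/
noncomputable def traceCLM : (E3 →L[ℝ] E3) →L[ℝ] ℝ :=
  ∑ i : Fin 3, (EuclideanSpace.proj i).comp (ContinuousLinearMap.apply ℝ E3 (stdVec i))

lemma div_eq_traceCLM (v : S2 → E3) (x : S2) :
    div v x = traceCLM (SphereHydro.tangentDeriv v x) := by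
  simp [div_eq_sum, traceCLM, Fin.sum_univ_three]

lemma IsSmoothInTime.grad (hJ : IsOpen J) {f : ℝ → S2 → ℝ} (hf : IsSmoothInTime J f) :
    IsSmoothInTime J (fun t x => grad (f t) x) :=
  ((hf.tangentDeriv hJ).clm dualVec).congr fun t _ x => congrFun (grad_eq_dualVec (f t)) x

lemma IsSmoothInTime.skewGrad (hJ : IsOpen J) {f : ℝ → S2 → ℝ} (hf : IsSmoothInTime J f) :
    IsSmoothInTime J (fun t x => skewGrad (f t) x) :=
  (IsSmoothInTime.bilin crossCLM (hf.grad hJ) isSmoothInTime_coe).congr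
    fun t _ x => skewGrad_eq_cross (f t) x

lemma IsSmoothInTime.div (hJ : IsOpen J) {v : ℝ → S2 → E3} (hv : IsSmoothInTime J v) :
    IsSmoothInTime J (fun t x => div (v t) x) :=
  ((hv.tangentDeriv hJ).clm traceCLM).congr fun t _ x => div_eq_traceCLM (v t) x

lemma IsSmoothInTime.curl (hJ : IsOpen J) {v : ℝ → S2 → E3} (hv : IsSmoothInTime J v) :
    IsSmoothInTime J (fun t x => curl (v t) x) :=
  IsSmoothInTime.div hJ (hv.bilin crossCLM isSmoothInTime_coe)

lemma IsSmoothInTime.covDeriv (hJ : IsOpen J) {u v : ℝ → S2 → E3} (hu : IsSmoothInTime J u)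
    (hv : IsSmoothInTime J v) : IsSmoothInTime J (fun t x => covDeriv (u t) (v t) x) := by
  have h1 : IsSmoothInTime J (fun t x => SphereHydro.tangentDeriv (v t) x (u t x)) :=
    IsSmoothInTime.bilin (ContinuousLinearMap.id ℝ (E3 →L[ℝ] E3)) (hv.tangentDeriv hJ) hu
  have h2 := (isSmoothInTime_coe.bilin dotCLM h1).bilin (ContinuousLinearMap.lsmul ℝ ℝ)
    isSmoothInTime_coe
  refine (h1.sub h2).congr fun t _ x => ?_
  simp [SphereHydro.covDeriv, covDiff, tangentProj_apply]

lemma IsSmoothInTime.differentiableAt (hJ : IsOpen J) {F : ℝ → S2 → V} (hF : IsSmoothInTime J F)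
    {t : ℝ} (ht : t ∈ J) (x : S2) : DifferentiableAt ℝ (radialExt (F t)) (x : E3) :=
  (hF.isRadiallySmooth hJ ht).differentiableAt x

/-- At fixed `x` the curl is a fixed linear combination of space derivatives, and these commute with
`∂ₜ`. -/
lemma IsSmoothInTime.hasDerivAt_curl (hJ : IsOpen J) {v : ℝ → S2 → E3} (hv : IsSmoothInTime J v)
    {t : ℝ} (ht : t ∈ J) (x : S2) :
    HasDerivAt (fun s => SphereHydro.curl (v s) x)
      (SphereHydro.curl (fun x => deriv (fun s => v s x) t) x) t := by
  have hd : ∀ i j, HasDerivAt (fun s => SphereHydro.tangentDeriv (v s) x (stdVec j) i)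
      (SphereHydro.tangentDeriv (fun x => deriv (fun s => v s x) t) x (stdVec j) i) t :=
    fun i j => (EuclideanSpace.proj (𝕜 := ℝ) i).hasFDerivAt.comp_hasDerivAt t
      (hv.hasDerivAt_tangentDeriv hJ ht x (stdVec j))
  rw [curl_eq_sum ((hv.timeDeriv hJ).differentiableAt hJ ht x)]
  refine HasDerivAt.congr_of_eventuallyEq
    (((((hd 2 1).sub (hd 1 2)).const_mul ((x : E3) 0)).add
    (((hd 0 2).sub (hd 2 0)).const_mul ((x : E3) 1))).add
    (((hd 1 0).sub (hd 0 1)).const_mul ((x : E3) 2))) ?_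
  filter_upwards [hJ.mem_nhds ht] with s hs
  exact curl_eq_sum (hv.differentiableAt hJ hs x)

/-- The acceleration of a velocity field. -/
noncomputable def acceleration (v : ℝ → S2 → E3) (t : ℝ) (x : S2) : E3 :=
  deriv (fun s => v s x) t + covDeriv (v t) (v t) x

lemma IsSmoothInTime.acceleration (hJ : IsOpen J) {v : ℝ → S2 → E3} (hv : IsSmoothInTime J v) :
    IsSmoothInTime J (acceleration v) :=
  (hv.timeDeriv hJ).add (hv.covDeriv hJ hv)

/-- The curl of the acceleration of a divergence-free velocity field. -/
lemma curl_acceleration (hJ : IsOpen J) {v : ℝ → S2 → E3} (hv : IsSmoothInTime J v)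
    (hvt : ∀ t ∈ J, IsTangent (v t)) {t : ℝ} (ht : t ∈ J) (hdiv : ∀ x, div (v t) x = 0) (x : S2) :
    curl (acceleration v t) x =
      deriv (fun s => curl (v s) x) t + ⟪grad (curl (v t)) x, v t x⟫ := by
  have hE : IsSmoothInTime J (fun t x => (2⁻¹ : ℝ) * ⟪v t x, v t x⟫) :=
    (hv.bilin ((2⁻¹ : ℝ) • dotCLM) hv).congr fun t _ x => by simp
  have hR : IsSmoothInTime J (fun t x => curl (v t) x • cross (x : E3) (v t x)) :=
    (hv.curl hJ).bilin (ContinuousLinearMap.lsmul ℝ ℝ) (isSmoothInTime_coe.bilin crossCLM hv)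
  have h1 : acceleration v t = fun x => deriv (fun s => v s x) t +
      (grad (fun x => (2⁻¹ : ℝ) * ⟪v t x, v t x⟫) x +
        curl (v t) x • cross (x : E3) (v t x)) := by
    ext1 x
    rw [acceleration, covDeriv_self (hv.differentiableAt hJ ht x) (hvt t ht)]
  have hG := (hE.grad hJ).differentiableAt hJ ht x
  rw [h1, curl_add ((hv.timeDeriv hJ).differentiableAt hJ ht x)
    (((hE.grad hJ).add hR).differentiableAt hJ ht x),
    curl_add hG (hR.differentiableAt hJ ht x), curl_grad (hE.isRadiallySmooth hJ ht),
    curl_smul_cross ((hv.curl hJ).differentiableAt hJ ht x) (hv.differentiableAt hJ ht x)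
    (hvt t ht), hdiv, (hv.hasDerivAt_curl hJ ht x).deriv]
  ring

/-- Differentiate `⟨x, v⟩ = 0` in time at fixed `x`; the convective term is tangential by
construction. -/
lemma isTangent_acceleration (hJ : IsOpen J) {v : ℝ → S2 → E3} (hv : IsSmoothInTime J v)
    (hvt : ∀ t ∈ J, IsTangent (v t)) {t : ℝ} (ht : t ∈ J) : IsTangent (acceleration v t) := by
  intro x
  have h1 : HasDerivAt (fun s => ⟪(x : E3), v s x⟫)
      ⟪(x : E3), fderiv ℝ (timeExt v) (t, (x : E3)) (1, 0)⟫ t :=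
    (dotCLM (x : E3)).hasFDerivAt.comp_hasDerivAt t (hv.hasDerivAt hJ ht x)
  have h2 : HasDerivAt (fun s => ⟪(x : E3), v s x⟫) 0 t := by
    refine (hasDerivAt_const t (0 : ℝ)).congr_of_eventuallyEq ?_
    filter_upwards [hJ.mem_nhds ht] with s hs using hvt s hs x
  rw [acceleration, (hv.hasDerivAt hJ ht x).deriv, inner_add_right, h1.unique h2]
  simp [covDeriv, covDiff, tangentProj_apply, inner_sub_right, inner_smul_right]

end Time

/-! ### Smooth dependence of integrals on parameters -/

section Parametric

universe u
variable {E V : Type u} {Y : Type*} [NormedAddCommGroup E] [NormedSpace ℝ E] [ProperSpace E]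
  [NormedAddCommGroup V] [NormedSpace ℝ V]
  [NormedAddCommGroup Y] [NormedSpace ℝ Y] [MeasurableSpace Y] [BorelSpace Y]
  {μ : Measure Y} [IsFiniteMeasureOnCompacts μ] {K : Set Y} {U : Set E} {Ω : Set (E × Y)}

omit [NormedSpace ℝ E] [ProperSpace E] [NormedSpace ℝ Y] [MeasurableSpace Y] [BorelSpace Y] in
lemma continuousOn_prodMk_of_mem {X : Type*} [TopologicalSpace X] {f : E × Y → X}
    (hf : ContinuousOn f Ω) (hUK : U ×ˢ K ⊆ Ω) {e : E} (he : e ∈ U) :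
    ContinuousOn (fun y => f (e, y)) K :=
  hf.comp (by fun_prop) fun _ hy => hUK ⟨he, hy⟩

/-- Differentiation under the integral sign over a compact set. -/
theorem hasFDerivAt_setIntegral (hK : IsCompact K) (hU : IsOpen U) (hΩ : IsOpen Ω)
    (hUK : U ×ˢ K ⊆ Ω) {f : E × Y → V} (hf : ContDiffOn ℝ 1 f Ω) {e : E} (he : e ∈ U) :
    HasFDerivAt (fun e => ∫ y in K, f (e, y) ∂μ)
      (∫ y in K, (fderiv ℝ f (e, y)).comp (ContinuousLinearMap.inl ℝ E Y) ∂μ) e := by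
  have hf' : ContinuousOn (fun z => (fderiv ℝ f z).comp (ContinuousLinearMap.inl ℝ E Y)) Ω :=
    (hf.continuousOn_fderiv_of_isOpen hΩ le_rfl).clm_comp continuousOn_const
  -- Closed balls are compact in a proper space, so the derivative has a constant bound near `e`,
  -- uniformly over `K`.
  obtain ⟨r, hr, hrU⟩ := Metric.nhds_basis_closedBall.mem_iff.1 (hU.mem_nhds he)
  obtain ⟨C, hC⟩ := ((isCompact_closedBall e r).prod hK).exists_bound_of_continuousOn
    (hf'.mono ((prod_mono_left hrU).trans hUK))
  refine hasFDerivAt_integral_of_dominated_of_fderiv_le (bound := fun _ => C)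
    (F' := fun e y => (fderiv ℝ f (e, y)).comp (ContinuousLinearMap.inl ℝ E Y))
    (Metric.closedBall_mem_nhds e hr) ?_ ?_ ?_ ?_ ?_ ?_
  · filter_upwards [hU.mem_nhds he] with e' he'
    exact (continuousOn_prodMk_of_mem hf.continuousOn hUK he').aestronglyMeasurable_of_isCompact hK
      hK.measurableSet
  · exact (continuousOn_prodMk_of_mem hf.continuousOn hUK he).integrableOn_compact hK
  · exact (continuousOn_prodMk_of_mem hf' hUK he).aestronglyMeasurable_of_isCompact hK
      hK.measurableSet
  · filter_upwards [ae_restrict_mem hK.measurableSet] with y hy e' he'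
    exact hC (e', y) ⟨he', hy⟩
  · have : IsFiniteMeasure (μ.restrict K) := ⟨by simpa using hK.measure_lt_top⟩
    exact integrable_const C
  · filter_upwards [ae_restrict_mem hK.measurableSet] with y hy e' he'
    have hmem : (e', y) ∈ Ω := hUK ⟨hrU he', hy⟩
    exact ((hf.contDiffAt (hΩ.mem_nhds hmem)).differentiableAt (by simp)).hasFDerivAt.comp e'
      (hasFDerivAt_prodMk_left e' y)

/-- The derivative of the integral is again such an integral, with values in `E →L[ℝ] V`. The
induction therefore runs over all target spaces, which is why `E` and `V` share a universe. -/
theorem contDiffOn_setIntegral_nat (hK : IsCompact K) (hU : IsOpen U) (hΩ : IsOpen Ω)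
    (hUK : U ×ˢ K ⊆ Ω) (n : ℕ) : ∀ {V : Type u} [NormedAddCommGroup V] [NormedSpace ℝ V]
    {f : E × Y → V}, ContDiffOn ℝ ∞ f Ω → ContDiffOn ℝ n (fun e => ∫ y in K, f (e, y) ∂μ) U := by
  induction n with
  | zero =>
    intro V _ _ f hf
    refine contDiffOn_zero.2 fun e he => ?_
    exact (hasFDerivAt_setIntegral hK hU hΩ hUK (hf.of_le (by norm_cast))
      he).continuousAt.continuousWithinAt
  | succ n ih =>
    intro V _ _ f hf
    have hd := fun e he => hasFDerivAt_setIntegral (μ := μ) hK hU hΩ hUK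
      (hf.of_le (m := 1) (by norm_cast)) (e := e) he
    rw [Nat.cast_add, Nat.cast_one, contDiffOn_succ_iff_fderiv_of_isOpen hU]
    refine ⟨fun e he => (hd e he).differentiableAt.differentiableWithinAt, by simp, ?_⟩
    refine (ih ((hf.fderiv_of_isOpen (m := ∞) hΩ (by simp)).clm_comp
      contDiffOn_const)).congr fun e he => (hd e he).fderiv

/-- Integrals over compact sets of functions depending smoothly on parameters are smooth. -/
theorem contDiffOn_setIntegral (hK : IsCompact K) (hU : IsOpen U) (hΩ : IsOpen Ω)
    (hUK : U ×ˢ K ⊆ Ω) {f : E × Y → V} (hf : ContDiffOn ℝ ∞ f Ω) :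
    ContDiffOn ℝ ∞ (fun e => ∫ y in K, f (e, y) ∂μ) U :=
  contDiffOn_infty.2 fun n => contDiffOn_setIntegral_nat hK hU hΩ hUK n hf

end Parametric

/-! ### The Poincaré lemma for one-forms -/

section Poincare

variable {E : Type} [NormedAddCommGroup E] [NormedSpace ℝ E] [ProperSpace E]

/-- The integral of a one-form along the segment from `a` to `x`. -/
noncomputable def segmentIntegral (A : E → E →L[ℝ] ℝ) (a x : E) : ℝ :=
  ∫ s in Icc (0 : ℝ) 1, A (a + s • (x - a)) (x - a)

/-- With `γ s = a + s (x - a)`, differentiating under the integral in direction `h` gives the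
integrand `A(γ s) h + s DA(γ s)(h)(x - a)`. Symmetry of `DA` turns it into the `s`-derivative of `s
A(γ s) h`, which integrates to `A(x) h`. -/
lemma segmentIntegral_hasFDerivAt {A : E → E →L[ℝ] ℝ} {U : Set E} {a : E} (hU : IsOpen U)
    (ha : StarConvex ℝ a U) (hA : ContDiffOn ℝ ∞ A U)
    (hsymm : ∀ x ∈ U, ∀ u w, fderiv ℝ A x u w = fderiv ℝ A x w u) {x : E} (hx : x ∈ U) :
    HasFDerivAt (segmentIntegral A a) (A x) x := by
  set Ω : Set (E × ℝ) := (fun z : E × ℝ => a + z.2 • (z.1 - a)) ⁻¹' U with hΩdef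
  have hΩ : IsOpen Ω := hU.preimage (by fun_prop)
  have hUK : U ×ˢ Icc (0 : ℝ) 1 ⊆ Ω := fun z hz =>
    ha.add_smul_sub_mem hz.1 hz.2.1 hz.2.2
  set f : E × ℝ → ℝ := fun z => A (a + z.2 • (z.1 - a)) (z.1 - a) with hfdef
  have hf : ContDiffOn ℝ ∞ f Ω :=
    (hA.comp (t := U) (s := Ω) (f := fun z : E × ℝ => a + z.2 • (z.1 - a))
      (by fun_prop) fun z hz => hz).clm_apply (by fun_prop)
  have hf1 : ContDiffOn ℝ 1 f Ω := hf.of_le (by norm_cast)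
  have hmain := hasFDerivAt_setIntegral (μ := volume) isCompact_Icc hU hΩ hUK hf1 hx
  refine hmain.congr_fderiv ?_
  have hcont : ContinuousOn (fun s : ℝ => (fderiv ℝ f (x, s)).comp
      (ContinuousLinearMap.inl ℝ E ℝ)) (Icc 0 1) :=
    continuousOn_prodMk_of_mem (f := fun z => (fderiv ℝ f z).comp (ContinuousLinearMap.inl ℝ E ℝ))
      ((hf1.continuousOn_fderiv_of_isOpen hΩ le_rfl).clm_comp continuousOn_const) hUK hx
  ext h
  rw [ContinuousLinearMap.integral_apply (hcont.integrableOn_compact isCompact_Icc),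
    integral_Icc_eq_integral_Ioc, ← intervalIntegral.integral_of_le zero_le_one]
  have hdiffA : ∀ s ∈ Icc (0 : ℝ) 1, HasFDerivAt A (fderiv ℝ A (a + s • (x - a)))
      (a + s • (x - a)) := fun s hs =>
    ((hA.contDiffAt (hU.mem_nhds (hUK (a := (x, s)) ⟨hx, hs⟩))).differentiableAt
      (by simp)).hasFDerivAt
  have hL : ∀ s ∈ Icc (0 : ℝ) 1, (fderiv ℝ f (x, s)).comp (ContinuousLinearMap.inl ℝ E ℝ) h =
      A (a + s • (x - a)) h + s • fderiv ℝ A (a + s • (x - a)) h (x - a) := by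
    intro s hs
    have h1 : HasFDerivAt (fun x' => f (x', s))
        ((fderiv ℝ f (x, s)).comp (ContinuousLinearMap.inl ℝ E ℝ)) x :=
      ((hf.contDiffAt (hΩ.mem_nhds (hUK ⟨hx, hs⟩))).differentiableAt
        (by simp)).hasFDerivAt.comp x (hasFDerivAt_prodMk_left x s)
    have h2 : HasFDerivAt (fun x' : E => a + s • (x' - a)) (s • ContinuousLinearMap.id ℝ E) x :=
      (((hasFDerivAt_id x).sub_const a).const_smul s).const_add a
    have h3 := ((hdiffA s hs).comp x h2).clm_apply ((hasFDerivAt_id x).sub_const a)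
    rw [h1.unique h3]
    simp
  have hd : ∀ s ∈ uIcc (0 : ℝ) 1, HasDerivAt (fun s : ℝ => s * A (a + s • (x - a)) h)
      ((fderiv ℝ f (x, s)).comp (ContinuousLinearMap.inl ℝ E ℝ) h) s := by
    intro s hs
    rw [uIcc_of_le zero_le_one] at hs
    have h2 : HasDerivAt (fun s : ℝ => a + s • (x - a)) ((1 : ℝ) • (x - a)) s :=
      ((hasDerivAt_id s).smul_const _).const_add a
    have h3 := (ContinuousLinearMap.apply ℝ ℝ h).hasFDerivAt.comp_hasDerivAt s
      ((hdiffA s hs).comp_hasDerivAt s h2)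
    rw [hL s hs, hsymm _ (hUK (a := (x, s)) ⟨hx, hs⟩)]
    refine ((hasDerivAt_id s).mul h3).congr_deriv ?_
    simp
  rw [intervalIntegral.integral_eq_sub_of_hasDerivAt hd]
  · simp
  · refine ContinuousOn.intervalIntegrable ?_
    rw [uIcc_of_le zero_le_one]
    exact hcont.clm_apply continuousOn_const

lemma segmentIntegral_contDiffOn {J : Set ℝ} (hJ : IsOpen J) {α : ℝ × E → E →L[ℝ] ℝ} {U : Set E}
    {a : E} (hU : IsOpen U) (ha : StarConvex ℝ a U) (hα : ContDiffOn ℝ ∞ α (J ×ˢ U)) :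
    ContDiffOn ℝ ∞ (fun z : ℝ × E => segmentIntegral (fun y => α (z.1, y)) a z.2) (J ×ˢ U) := by
  set g : (ℝ × E) × ℝ → ℝ × E := fun z => (z.1.1, a + z.2 • (z.1.2 - a)) with hg
  have hgs : ContDiff ℝ ∞ g := by fun_prop
  refine contDiffOn_setIntegral (Ω := g ⁻¹' (J ×ˢ U)) (K := Icc 0 1)
    (f := fun z : (ℝ × E) × ℝ => α (g z) (z.1.2 - a)) isCompact_Icc (hJ.prod hU)
    ((hJ.prod hU).preimage hgs.continuous) ?_ ?_
  · rintro ⟨⟨t, x⟩, s⟩ ⟨⟨ht, hx⟩, hs⟩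
    exact ⟨ht, ha.add_smul_sub_mem hx hs.1 hs.2⟩
  · exact (hα.comp hgs.contDiffOn fun z hz => hz).clm_apply (by fun_prop)

/-- `ℝ³` minus the closed ray opposite to `σ e₀`. -/
def slitSpace (σ : ℝ) : Set E3 := {y | 0 < σ * y 0 ∨ y 1 ≠ 0 ∨ y 2 ≠ 0}

lemma isOpen_slitSpace (σ : ℝ) : IsOpen (slitSpace σ) := by
  have h : ∀ i, Continuous fun y : E3 => y i := fun i => (EuclideanSpace.proj (𝕜 := ℝ) i).continuous
  exact (isOpen_lt continuous_const (continuous_const.mul (h 0))).union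
    ((isOpen_ne_fun (h 1) continuous_const).union (isOpen_ne_fun (h 2) continuous_const))

lemma starConvex_slitSpace {σ : ℝ} (hσ : 0 < σ * σ) :
    StarConvex ℝ (σ • stdVec 0) (slitSpace σ) := by
  intro y hy p q hp hq hpq
  simp only [slitSpace, mem_ofPred_eq] at hy ⊢
  simp only [PiLp.add_apply, PiLp.smul_apply, stdVec_apply, smul_eq_mul]
  rcases hq.eq_or_lt with rfl | hq
  · left
    have : p = 1 := by linarith
    simp [this, hσ]
  · rcases hy with hy | hy | hy
    · left
      have : σ * (p * (σ * 1) + q * y 0) = p * (σ * σ) + q * (σ * y 0) := by ring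
      simp only [if_true]
      rw [this]
      positivity
    · right; left
      simp [hq.ne', hy]
    · right; right
      simp [hq.ne', hy]

lemma mem_slitSpace_or {y : E3} (hy : y ≠ 0) : y ∈ slitSpace 1 ∨ y ∈ slitSpace (-1) := by
  by_contra! h
  simp only [slitSpace, mem_ofPred_eq, not_or, not_lt, not_not] at h
  refine hy (ext3 ?_ h.1.2.1 h.1.2.2)
  simp
  linarith [h.1.1, h.2.1]

lemma ne_zero_of_mem_slitSpace {σ : ℝ} {y : E3} (hy : y ∈ slitSpace σ) : y ≠ 0 := by
  rintro rfl
  simp [slitSpace] at hy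

/-- The overlap is the complement of a line in `ℝ³`, and subspaces of codimension at least two do
not disconnect. -/
lemma isPreconnected_slitSpace_inter : IsPreconnected (slitSpace 1 ∩ slitSpace (-1)) := by
  have h : slitSpace 1 ∩ slitSpace (-1) = ((Submodule.span ℝ {stdVec 0} : Submodule ℝ E3) : Set E3)ᶜ := by
    ext y
    simp only [slitSpace, mem_inter_iff, mem_ofPred_eq, mem_compl_iff, SetLike.mem_coe,
      Submodule.mem_span_singleton]
    constructor
    · rintro ⟨h1, h2⟩ ⟨c, rfl⟩
      simp [stdVec_apply] at h1 h2
      linarith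
    · intro h
      have : y 1 ≠ 0 ∨ y 2 ≠ 0 := by
        by_contra! h'
        exact h ⟨y 0, ext3 (by simp [stdVec_apply]) (by simp [stdVec_apply, h'.1])
          (by simp [stdVec_apply, h'.2])⟩
      exact ⟨Or.inr this, Or.inr this⟩
  rw [h]
  refine (isConnected_compl_of_one_lt_codim ?_).isPreconnected
  rw [← Module.finrank_eq_rank, Submodule.finrank_quotient, finrank_euclideanSpace_fin,
    finrank_span_singleton]
  · norm_num
  · intro h0
    have := congrArg (fun y : E3 => y 0) h0
    simp [stdVec_apply] at this

/-- A closed one-form on `ℝ³ ∖ {0}` depending smoothly on time has a primitive that depends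
smoothly on time. -/
theorem exists_primitive {J : Set ℝ} (hJ : IsOpen J) {α : ℝ × E3 → E3 →L[ℝ] ℝ}
    (hα : ContDiffOn ℝ ∞ α (J ×ˢ {0}ᶜ))
    (hsymm : ∀ t ∈ J, ∀ y : E3, y ≠ 0 → ∀ u w,
      fderiv ℝ (fun y => α (t, y)) y u w = fderiv ℝ (fun y => α (t, y)) y w u) :
    ∃ P : ℝ × E3 → ℝ, ContDiffOn ℝ ∞ P (J ×ˢ {0}ᶜ) ∧
      ∀ t ∈ J, ∀ y : E3, y ≠ 0 → HasFDerivAt (fun y => P (t, y)) (α (t, y)) y := by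
  classical
  set Q : ℝ → ℝ × E3 → ℝ := fun σ z =>
    segmentIntegral (fun y => α (z.1, y)) (σ • stdVec 0) z.2 with hQ
  have hsub : ∀ σ, J ×ˢ slitSpace σ ⊆ J ×ˢ ({0}ᶜ : Set E3) := fun σ z hz =>
    ⟨hz.1, ne_zero_of_mem_slitSpace hz.2⟩
  have hQs : ∀ σ, 0 < σ * σ → ContDiffOn ℝ ∞ (Q σ) (J ×ˢ slitSpace σ) := fun σ hσ =>
    segmentIntegral_contDiffOn hJ (isOpen_slitSpace σ) (starConvex_slitSpace hσ)
      (hα.mono (hsub σ))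
  have hQd : ∀ σ, 0 < σ * σ → ∀ t ∈ J, ∀ y ∈ slitSpace σ,
      HasFDerivAt (fun y => Q σ (t, y)) (α (t, y)) y := fun σ hσ t ht y hy =>
    segmentIntegral_hasFDerivAt (isOpen_slitSpace σ) (starConvex_slitSpace hσ)
      ((hα.mono (hsub σ)).comp (contDiff_prodMk_right t).contDiffOn fun z hz => ⟨ht, hz⟩)
      (fun x hx => hsymm t ht x (ne_zero_of_mem_slitSpace hx)) hy
  have h1 : (0 : ℝ) < 1 * 1 := by norm_num
  have h2 : (0 : ℝ) < (-1) * (-1) := by norm_num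
  -- On the connected overlap the two primitives differ by a function of time alone, read off at a
  -- point common to both slit spaces; this makes it smooth in `t`.
  set c : ℝ → ℝ := fun t => Q 1 (t, stdVec 1) - Q (-1) (t, stdVec 1) with hc
  have hmem : ∀ σ, stdVec 1 ∈ slitSpace σ := fun σ => Or.inr (Or.inl (by simp [stdVec_apply]))
  have hcs : ContDiffOn ℝ ∞ c J :=
    ((hQs 1 h1).comp (f := fun t => (t, stdVec 1)) (by fun_prop) fun t ht => ⟨ht, hmem 1⟩).sub
      ((hQs (-1) h2).comp (f := fun t => (t, stdVec 1)) (by fun_prop) fun t ht => ⟨ht, hmem (-1)⟩)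
  have heq : ∀ t ∈ J, ∀ y ∈ slitSpace 1 ∩ slitSpace (-1), Q 1 (t, y) = Q (-1) (t, y) + c t := by
    intro t ht y hy
    have hd : ∀ y ∈ slitSpace 1 ∩ slitSpace (-1),
        HasFDerivAt (fun y => Q 1 (t, y) - Q (-1) (t, y)) (0 : E3 →L[ℝ] ℝ) y := fun y hy =>
      ((hQd 1 h1 t ht y hy.1).sub (hQd (-1) h2 t ht y hy.2)).congr_fderiv (sub_self _)
    have := ((isOpen_slitSpace 1).inter (isOpen_slitSpace (-1))).is_const_of_fderiv_eq_zero
      isPreconnected_slitSpace_inter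
      (fun y hy => (hd y hy).differentiableAt.differentiableWithinAt)
      (fun y hy => (hd y hy).fderiv) hy ⟨hmem 1, hmem (-1)⟩
    simp only [hc]
    linarith
  set P : ℝ × E3 → ℝ := fun z => if z.2 ∈ slitSpace 1 then Q 1 z else Q (-1) z + c z.1 with hP
  have hP1 : ∀ z : ℝ × E3, z.2 ∈ slitSpace 1 → P z = Q 1 z := fun z hz => by simp [hP, hz]
  have hP2 : ∀ z ∈ J ×ˢ slitSpace (-1), P z = Q (-1) z + c z.1 := fun z hz => by
    by_cases hz1 : z.2 ∈ slitSpace 1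
    · rw [hP1 z hz1, ← heq z.1 hz.1 z.2 ⟨hz1, hz.2⟩]
    · simp [hP, hz1]
  refine ⟨P, fun z hz => ?_, fun t ht y hy => ?_⟩
  · rcases mem_slitSpace_or hz.2 with hy | hy
    · have hn := (hJ.prod (isOpen_slitSpace 1)).mem_nhds ⟨hz.1, hy⟩
      exact (((hQs 1 h1).contDiffAt hn).congr_of_eventuallyEq
        (by filter_upwards [hn] with w hw using hP1 w hw.2)).contDiffWithinAt
    · have hn := (hJ.prod (isOpen_slitSpace (-1))).mem_nhds ⟨hz.1, hy⟩
      have hs : ContDiffOn ℝ ∞ (fun z : ℝ × E3 => Q (-1) z + c z.1) (J ×ˢ slitSpace (-1)) :=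
        (hQs (-1) h2).add (hcs.comp contDiffOn_fst fun w hw => hw.1)
      exact ((hs.contDiffAt hn).congr_of_eventuallyEq
        (by filter_upwards [hn] with w hw using hP2 w hw)).contDiffWithinAt
  · rcases mem_slitSpace_or hy with hy | hy
    · refine (hQd 1 h1 t ht y hy).congr_of_eventuallyEq ?_
      filter_upwards [(isOpen_slitSpace 1).mem_nhds hy] with w hw using hP1 (t, w) hw
    · refine ((hQd (-1) h2 t ht y hy).add_const (c t)).congr_of_eventuallyEq ?_
      filter_upwards [(isOpen_slitSpace (-1)).mem_nhds hy] with w hw using hP2 (t, w) ⟨ht, hw⟩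

/-! ### Potentials of curl-free fields on the sphere -/

/-- Closedness of the pulled-back one-form. The antisymmetric part of `Dv` is `⟨c, u × w⟩` for the
flat curl `c`. Here `c = x × v`, because `c × x = v` and its normal component, the scalar curl, is
zero. Expanding `⟨x × v, u × w⟩` gives the two correction terms. -/
lemma inner_tangentDeriv_symm_of_curl_eq_zero {v : S2 → E3} {x : S2}
    (hv : DifferentiableAt ℝ (radialExt v) (x : E3)) (hvt : IsTangent v) (hc : curl v x = 0)
    (u w : E3) :
    ⟪tangentDeriv v x u, w⟫ - ⟪(x : E3), u⟫ * ⟪v x, w⟫ =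
      ⟪tangentDeriv v x w, u⟫ - ⟪(x : E3), w⟫ * ⟪v x, u⟫ := by
  have hn := fun i => inner_coe_tangentDeriv hv hvt (stdVec i)
  have hs := sum_coe_smul_tangentDeriv v x
  have hs0 := congrArg (fun a : E3 => a 0) hs
  have hs1 := congrArg (fun a : E3 => a 1) hs
  have hs2 := congrArg (fun a : E3 => a 2) hs
  have hx := sum_sq_coe x
  have hn0 := hn 0
  have hn1 := hn 1
  have hn2 := hn 2
  rw [curl_eq_sum hv] at hc
  rw [map_eq_sum3 (tangentDeriv v x) u, map_eq_sum3 (tangentDeriv v x) w]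
  simp [inner_eq_sum3, stdVec_apply] at hn0 hn1 hn2 hs0 hs1 hs2
  clear hs hn hvt
  generalize tangentDeriv v x (stdVec 0) = A at *
  generalize tangentDeriv v x (stdVec 1) = B at *
  generalize tangentDeriv v x (stdVec 2) = C at *
  generalize v x = a at *
  generalize (x : E3) = y at *
  have e0 : (C 0 - A 2) * y 2 - (A 1 - B 0) * y 1 = a 0 := by linear_combination hs0 - hn0
  have e1 : (A 1 - B 0) * y 0 - (B 2 - C 1) * y 2 = a 1 := by linear_combination hs1 - hn1
  have e2 : (B 2 - C 1) * y 1 - (C 0 - A 2) * y 0 = a 2 := by linear_combination hs2 - hn2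
  have k0 : B 2 - C 1 = y 1 * a 2 - y 2 * a 1 := by
    linear_combination y 1 * e2 - y 2 * e1 - (B 2 - C 1) * hx + y 0 * hc
  have k1 : C 0 - A 2 = y 2 * a 0 - y 0 * a 2 := by
    linear_combination y 2 * e0 - y 0 * e2 - (C 0 - A 2) * hx + y 1 * hc
  have k2 : A 1 - B 0 = y 0 * a 1 - y 1 * a 0 := by
    linear_combination y 0 * e1 - y 1 * e0 - (A 1 - B 0) * hx + y 2 * hc
  simp [inner_eq_sum3]
  linear_combination (u 1 * w 2 - u 2 * w 1) * k0 + (u 2 * w 0 - u 0 * w 2) * k1 +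
    (u 0 * w 1 - u 1 * w 0) * k2

lemma hasFDerivAt_inv_norm {y : E3} (hy : y ≠ 0) :
    HasFDerivAt (fun y : E3 => ‖y‖⁻¹) (-(‖y‖⁻¹ ^ 3) • dotCLM y) y := by
  have hn : ‖y‖ ≠ 0 := norm_ne_zero_iff.2 hy
  have h := (hasStrictFDerivAt_norm_sq y).hasFDerivAt.sqrt (by simpa using hy)
  simp only [Real.sqrt_sq (norm_nonneg _)] at h
  have h1 := (hasDerivAt_inv hn).comp_hasFDerivAt y h
  refine h1.congr_fderiv ?_
  ext w
  simp [innerSL_apply_apply]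
  field_simp

/-- A curl-free tangent field on the sphere that depends smoothly on time is the gradient of a
potential that depends smoothly on time. -/
theorem exists_potential {J : Set ℝ} (hJ : IsOpen J) {F : ℝ → S2 → E3} (hF : IsSmoothInTime J F)
    (hFt : ∀ t ∈ J, IsTangent (F t)) (hc : ∀ t ∈ J, ∀ x, curl (F t) x = 0) :
    ∃ p : ℝ → S2 → ℝ, IsSmoothInTime J p ∧ ∀ t ∈ J, grad (p t) = F t := by
  -- The pullback of `⟨F, ·⟩` along `y ↦ y / |y|`: the differential of that map is `|y|⁻¹` times the
  -- tangential projection, which tangency of `F` makes invisible.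
  set α : ℝ × E3 → E3 →L[ℝ] ℝ := fun z => ‖z.2‖⁻¹ • dotCLM (radialExt (F z.1) z.2) with hα
  have hαs : ContDiffOn ℝ ∞ α (J ×ˢ {0}ᶜ) := by
    have h1 : ContDiffOn ℝ ∞ (fun z : ℝ × E3 => ‖z.2‖⁻¹) (J ×ˢ {0}ᶜ) :=
      (contDiffOn_snd.norm ℝ fun z hz => hz.2).inv fun z hz => norm_ne_zero_iff.2 hz.2
    exact h1.smul (dotCLM.contDiff.comp_contDiffOn (hF.contDiffOn_radialExt hJ))
  have hαd : ∀ t ∈ J, ∀ y : E3, ∀ hy : y ≠ 0, ∀ u w, fderiv ℝ (fun y => α (t, y)) y u w =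
      ‖y‖⁻¹ ^ 2 * (⟪tangentDeriv (F t) (radialProj y hy) u, w⟫ -
        ⟪((radialProj y hy : S2) : E3), u⟫ * ⟪F t (radialProj y hy), w⟫) := by
    intro t ht y hy u w
    have hR : HasFDerivAt (radialExt (F t)) (fderiv ℝ (radialExt (F t)) y) y :=
      (((hF.isRadiallySmooth hJ ht).contDiffAt hy).differentiableAt (by simp)).hasFDerivAt
    have h1 := (hasFDerivAt_inv_norm hy).smul (dotCLM.hasFDerivAt.comp y hR)
    have h2 : fderiv ℝ (fun y => α (t, y)) y = _ := h1.fderiv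
    rw [h2, fderiv_radialExt _ hy]
    simp [radialExt_of_ne _ hy, radialProj, inner_smul_left]
    ring
  obtain ⟨P, hPs, hPd⟩ := exists_primitive hJ hαs fun t ht y hy u w => by
    rw [hαd t ht y hy, hαd t ht y hy, inner_tangentDeriv_symm_of_curl_eq_zero
      (hF.differentiableAt hJ ht _) (hFt t ht) (hc t ht _)]
  refine ⟨fun t x => P (t, x), isSmoothInTime_of_contDiffOn hPs, fun t ht => ?_⟩
  ext1 x
  refine ext_inner_right ℝ fun w => ?_
  have h1 : HasFDerivAt (fun y => P (t, y)) (α (t, (x : E3)))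
      (radialExt (fun x : S2 => (x : E3)) (x : E3)) := by
    rw [radialExt_coe]
    exact hPd t ht x (coe_ne_zero x)
  have h2 := h1.comp (x : E3) (hasFDerivAt_radialExt_coe x)
  have h3 : radialExt (fun x : S2 => P (t, x)) =ᶠ[𝓝 (x : E3)]
      (fun y => P (t, y)) ∘ radialExt (fun x : S2 => (x : E3)) :=
    radialExt_eventuallyEq (fun y hy => by simp [radialExt_of_ne _ hy]) (coe_ne_zero x)
  rw [inner_grad, tangentDeriv, (h2.congr_of_eventuallyEq h3).fderiv]
  have := hFt t ht x
  rw [real_inner_comm] at this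
  simp [hα, tangentProj_apply, inner_sub_right, inner_smul_right, this]

end Poincare

/-! ### Integration on the sphere -/

section Integration

instance : IsFiniteMeasure area := inferInstanceAs (IsFiniteMeasure (Measure.toSphere volume))

lemma area_real_univ_ne_zero : area.real univ ≠ 0 := by
  have : area ≠ 0 := Measure.toSphere_ne_zero (volume : Measure E3)
  simpa [measureReal_def, ENNReal.toReal_eq_zero_iff] using this

lemma integrable_of_continuous {f : S2 → ℝ} (hf : Continuous f) : Integrable f area := by
  simpa using hf.continuousOn.integrableOn_compact (isCompact_univ (X := S2)) (μ := area)

/-- Integration in polar coordinates. -/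
lemma integral_radial_mul_radialExt (g : ℝ → ℝ) (h : S2 → ℝ) :
    ∫ y : E3, g ‖y‖ * radialExt h y = (∫ x, h x ∂area) * ∫ r in Ioi (0 : ℝ), r ^ 2 * g r :=
  calc
    ∫ y : E3, g ‖y‖ * radialExt h y =
        ∫ y : ({0}ᶜ : Set E3), g ‖y.1‖ * radialExt h y.1 ∂(volume.comap Subtype.val) := by
      rw [integral_subtype_comap (measurableSet_singleton _).compl
        fun y : E3 => g ‖y‖ * radialExt h y, restrict_compl_singleton]
    _ = ∫ z : S2 × Ioi (0 : ℝ), h z.1 * g z.2 ∂area.prod (.volumeIoiPow 2) := by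
      have := (volume : Measure E3).measurePreserving_homeomorphUnitSphereProd.integral_comp
        (Homeomorph.measurableEmbedding _) (fun z : S2 × Ioi (0 : ℝ) => h z.1 * g z.2)
      rw [finrank_euclideanSpace_fin] at this
      rw [area, ← this]
      refine integral_congr_ae (.of_forall fun y => ?_)
      simp only [homeomorphUnitSphereProd_apply_snd_coe]
      rw [radialExt_of_ne h y.2, mul_comm]
      congr 2
      ext1
      simp [radialProj]
    _ = (∫ x, h x ∂area) * ∫ r : Ioi (0 : ℝ), g r ∂.volumeIoiPow 2 :=
      integral_prod_mul h fun r : Ioi (0 : ℝ) => g r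
    _ = _ := by
      congr 1
      simp only [Measure.volumeIoiPow, ENNReal.ofReal]
      rw [integral_withDensity_eq_integral_smul,
        integral_subtype_comap measurableSet_Ioi fun a => Real.toNNReal (a ^ 2) • g a]
      · refine setIntegral_congr_fun measurableSet_Ioi fun x hx => ?_
        simp only [NNReal.smul_def, Real.coe_toNNReal _ (sq_nonneg x), smul_eq_mul]
      · exact (measurable_subtype_coe.pow_const _).real_toNNReal

/-- A smooth bump function on the line supported near `1`. -/
noncomputable def bumpOne : ContDiffBump (1 : ℝ) := ⟨1 / 4, 1 / 2, by norm_num, by norm_num⟩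

lemma bumpOne_of_le {r : ℝ} (hr : r ≤ 1 / 2) : bumpOne r = 0 := by
  refine bumpOne.zero_of_le_dist ?_
  rw [Real.dist_eq, abs_sub_comm]
  exact le_trans (by simp only [bumpOne]; linarith) (le_abs_self _)

lemma bumpOne_of_ge {r : ℝ} (hr : 3 / 2 ≤ r) : bumpOne r = 0 := by
  refine bumpOne.zero_of_le_dist ?_
  rw [Real.dist_eq]
  exact le_trans (by simp only [bumpOne]; linarith) (le_abs_self _)

/-- A radial cutoff function on `ℝ³` vanishing near the origin. -/
noncomputable def radialCutoff (y : E3) : ℝ := bumpOne (‖y‖ ^ 2)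

lemma contDiff_radialCutoff : ContDiff ℝ ∞ radialCutoff :=
  bumpOne.contDiff.comp (contDiff_norm_sq ℝ)

lemma radialCutoff_of_norm_le {y : E3} (hy : ‖y‖ ≤ 1 / 2) : radialCutoff y = 0 :=
  bumpOne_of_le (by nlinarith [norm_nonneg y])

lemma tsupport_radialCutoff_subset : tsupport radialCutoff ⊆ {y | 1 / 2 ≤ ‖y‖} := by
  refine closure_minimal (fun y hy => ?_) (isClosed_le continuous_const continuous_norm)
  by_contra h
  exact hy (radialCutoff_of_norm_le (not_le.1 h).le)

lemma ne_zero_of_mem_tsupport_radialCutoff {y : E3} (hy : y ∈ tsupport radialCutoff) : y ≠ 0 := by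
  rintro rfl
  have := tsupport_radialCutoff_subset hy
  simp at this
  norm_num at this

lemma hasCompactSupport_radialCutoff : HasCompactSupport radialCutoff := by
  refine HasCompactSupport.intro (isCompact_closedBall (0 : E3) 2) fun y hy => bumpOne_of_ge ?_
  have : 2 < ‖y‖ := by simpa using hy
  nlinarith

lemma fderiv_radialCutoff_apply (y w : E3) :
    fderiv ℝ radialCutoff y w = 2 * deriv bumpOne (‖y‖ ^ 2) * ⟪y, w⟫ := by
  have h := ((bumpOne.contDiff (n := 1)).differentiable (by simp)
    (‖y‖ ^ 2)).hasDerivAt.comp_hasFDerivAt y (hasStrictFDerivAt_norm_sq y).hasFDerivAt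
  have h2 : fderiv ℝ radialCutoff y = _ := h.fderiv
  rw [h2]
  simp [innerSL_apply_apply]
  ring

/-- The gradient of a radial function is radial, hence orthogonal to a tangent field. -/
lemma fderiv_radialCutoff_inner_radialExt {v : S2 → E3} (hv : IsTangent v) (y : E3) :
    fderiv ℝ radialCutoff y (radialExt v y) = 0 := by
  by_cases hy : y = 0
  · simp [hy, radialExt]
  · have h := hv (radialProj y hy)
    simp [radialProj, inner_smul_left, hy] at h
    rw [fderiv_radialCutoff_apply, radialExt_of_ne v hy]
    simp [radialProj, h]

/-- A singularity of `g` at the origin is harmless, since `f` has compact support away from it. -/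
lemma integrable_mul_of_continuousOn {f g : E3 → ℝ} (hf : Continuous f)
    (hs : tsupport f ⊆ tsupport radialCutoff) (hg : ContinuousOn g {0}ᶜ) :
    Integrable (fun y => f y * g y) := by
  have hc : IsCompact (tsupport f) :=
    hasCompactSupport_radialCutoff.isCompact.of_isClosed_subset (isClosed_tsupport f) hs
  have h1 : IntegrableOn (fun y => f y * g y) (tsupport f) :=
    (hf.continuousOn.mul (hg.mono fun y hy =>
      ne_zero_of_mem_tsupport_radialCutoff (hs hy))).integrableOn_compact hc
  refine (integrableOn_iff_integrable_of_support_subset fun y hy => ?_).1 h1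
  refine subset_tsupport f fun h => hy ?_
  simp [h]

/-- This is the radial factor in the polar form of the flat integral; being nonzero, it can be
divided out. -/
lemma integral_mul_bumpOne_sq_pos : 0 < ∫ r in Ioi (0 : ℝ), r ^ 2 * (bumpOne (r ^ 2) * r⁻¹) := by
  have he : ∀ r ∈ Ioi (0 : ℝ), r ^ 2 * (bumpOne (r ^ 2) * r⁻¹) = r * bumpOne (r ^ 2) :=
    fun r hr => by
      have : r ≠ 0 := ne_of_gt hr
      field_simp
  rw [setIntegral_congr_fun measurableSet_Ioi he]
  have hcont : Continuous fun r : ℝ => r * bumpOne (r ^ 2) :=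
    continuous_id.mul (bumpOne.continuous.comp (continuous_pow 2))
  have hcs : HasCompactSupport fun r : ℝ => r * bumpOne (r ^ 2) := by
    refine HasCompactSupport.intro (isCompact_closedBall (0 : ℝ) 2) fun r hr => ?_
    have : 2 < |r| := by simpa using hr
    rw [bumpOne_of_ge, mul_zero]
    nlinarith [sq_abs r]
  rw [setIntegral_pos_iff_support_of_nonneg_ae]
  · have hsub : Ioo (1 : ℝ) (6 / 5) ⊆
        Function.support (fun r : ℝ => r * bumpOne (r ^ 2)) ∩ Ioi 0 := by
      intro r hr
      have hr0 : (0 : ℝ) < r := lt_trans one_pos hr.1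
      refine ⟨(mul_pos hr0 (bumpOne.pos_of_mem_ball ?_)).ne', hr0⟩
      rw [Metric.mem_ball, Real.dist_eq, abs_lt]
      simp only [bumpOne]
      constructor <;> nlinarith [hr.1, hr.2]
    refine lt_of_lt_of_le ?_ (measure_mono hsub)
    rw [Real.volume_Ioo]
    norm_num
  · filter_upwards [ae_restrict_mem measurableSet_Ioi] with r hr
    exact mul_nonneg (le_of_lt hr) bumpOne.nonneg
  · exact (hcont.integrable_of_hasCompactSupport hcs).integrableOn

/-- The divergence theorem on the sphere. -/
theorem integral_div_eq_zero {v : S2 → E3} (hv : IsRadiallySmooth v) (hvt : IsTangent v) :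
    ∫ x, div v x ∂area = 0 := by
  set g : Fin 3 → E3 → ℝ := fun i y => radialExt v y i with hg
  have hgs : ∀ i, ContDiffOn ℝ ∞ (g i) {0}ᶜ := fun i =>
    (EuclideanSpace.proj (𝕜 := ℝ) i).contDiff.comp_contDiffOn hv
  have hgd : ∀ i, ContinuousOn (fun y => fderiv ℝ (g i) y (stdVec i)) {0}ᶜ := fun i =>
    ((hgs i).continuousOn_fderiv_of_isOpen isOpen_compl_singleton (by simp)).clm_apply
      continuousOn_const
  have hX' : ∀ i, Continuous fun y => fderiv ℝ radialCutoff y (stdVec i) := fun i =>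
    (contDiff_radialCutoff.continuous_fderiv (by simp)).clm_apply continuous_const
  have hX's : ∀ i, tsupport (fun y => fderiv ℝ radialCutoff y (stdVec i)) ⊆
      tsupport radialCutoff := fun i => by
    refine closure_minimal (fun y hy => support_fderiv_subset ℝ fun h => hy ?_)
      (isClosed_tsupport _)
    simp [h]
  have hI1 : ∀ i, Integrable fun y => radialCutoff y * fderiv ℝ (g i) y (stdVec i) := fun i =>
    integrable_mul_of_continuousOn contDiff_radialCutoff.continuous subset_rfl (hgd i)
  have hI2 : ∀ i, Integrable fun y => fderiv ℝ radialCutoff y (stdVec i) * g i y := fun i =>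
    integrable_mul_of_continuousOn (hX' i) (hX's i) (hgs i).continuousOn
  have hibp : ∀ i, ∫ y, radialCutoff y * fderiv ℝ (g i) y (stdVec i) =
      -∫ y, fderiv ℝ radialCutoff y (stdVec i) * g i y := fun i =>
    integral_mul_fderiv_eq_neg_fderiv_mul_of_integrable (hI2 i) (hI1 i)
      (integrable_mul_of_continuousOn contDiff_radialCutoff.continuous subset_rfl
        (hgs i).continuousOn)
      (fun y _ => contDiff_radialCutoff.differentiable (by simp) y)
      (fun y hy => ((hgs i).contDiffAt (isOpen_ne.mem_nhds
        (ne_zero_of_mem_tsupport_radialCutoff hy))).differentiableAt (by simp))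
  -- After integration by parts only the derivative of the cutoff along the field remains, and it
  -- vanishes pointwise.
  have hR : ∫ y, ∑ i, fderiv ℝ radialCutoff y (stdVec i) * g i y = 0 := by
    rw [← integral_zero E3 ℝ]
    refine integral_congr_ae (.of_forall fun y => ?_)
    have h := fderiv_radialCutoff_inner_radialExt hvt y
    rw [map_eq_sum3 (fderiv ℝ radialCutoff y)] at h
    simp only [smul_eq_mul] at h
    simp only [Fin.sum_univ_three, hg]
    linarith
  have hL : ∫ y, ∑ i, radialCutoff y * fderiv ℝ (g i) y (stdVec i) = 0 := by
    rw [integral_finsetSum _ fun i _ => hI1 i]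
    rw [integral_finsetSum _ fun i _ => hI2 i] at hR
    simp only [hibp, Finset.sum_neg_distrib, hR, neg_zero]
  -- The weight `r⁻¹` appears because the flat divergence of the extension at `y` is `|y|⁻¹` times
  -- `div v` at `y / |y|`.
  have hpolar := integral_radial_mul_radialExt (fun r => bumpOne (r ^ 2) * r⁻¹) (div v)
  have heq : ∫ y : E3, bumpOne (‖y‖ ^ 2) * ‖y‖⁻¹ * radialExt (div v) y = 0 := by
    rw [← hL]
    refine integral_congr_ae (.of_forall fun y => ?_)
    by_cases hy : y = 0
    · simp [hy, radialExt, radialCutoff, bumpOne_of_le]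
    · have hd : HasFDerivAt (radialExt v) (fderiv ℝ (radialExt v) y) y :=
        ((hv.contDiffAt hy).differentiableAt (by simp)).hasFDerivAt
      have hgi : ∀ i, fderiv ℝ (g i) y (stdVec i) =
          ‖y‖⁻¹ * tangentDeriv v (radialProj y hy) (stdVec i) i := fun i => by
        have h1 := ((EuclideanSpace.proj (𝕜 := ℝ) i).hasFDerivAt.comp y hd).fderiv
        have h2 : fderiv ℝ (g i) y = _ := h1
        rw [h2, fderiv_radialExt v hy]
        simp
      simp only [Fin.sum_univ_three, hgi, radialExt_of_ne _ hy, div_eq_sum, radialCutoff]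
      ring
  rw [heq] at hpolar
  exact (mul_eq_zero.1 hpolar.symm).resolve_right integral_mul_bumpOne_sq_pos.ne'

lemma IsRadiallySmooth.isSmoothInTime {V : Type*} [NormedAddCommGroup V] [NormedSpace ℝ V]
    {F : S2 → V} (hF : IsRadiallySmooth F) : IsSmoothInTime univ (fun _ => F) :=
  (isSmoothInTime_of_contDiffOn (G := fun z => radialExt F z.2)
    (ContDiffOn.comp hF contDiffOn_snd fun _ hz => hz.2)).congr fun _ _ x => (radialExt_coe F x).symm

/-- Green's identity on the sphere. -/
theorem integral_inner_grad_grad {f g : S2 → ℝ} (hf : IsRadiallySmooth f)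
    (hg : IsRadiallySmooth g) :
    ∫ x, ⟪grad f x, grad g x⟫ ∂area = ∫ x, -laplacian f x * g x ∂area := by
  have hgf := hf.isSmoothInTime.grad isOpen_univ
  have hgg := hg.isSmoothInTime.grad isOpen_univ
  have hd := hgf.div isOpen_univ
  have hv : IsSmoothInTime univ (fun _ x => g x • grad f x) :=
    hg.isSmoothInTime.bilin (ContinuousLinearMap.lsmul ℝ ℝ) hgf
  have hvt : IsTangent fun x => g x • grad f x := fun x => by
    rw [inner_smul_right, inner_coe_grad, mul_zero]
  have h0 := integral_div_eq_zero (hv.isRadiallySmooth isOpen_univ (mem_univ 0)) hvt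
  have h1 : ∀ x, div (fun x => g x • grad f x) x = ⟪grad f x, grad g x⟫ - -laplacian f x * g x :=
    fun x => by
      rw [div_smul (hg.differentiableAt x) (hf.differentiableAt_grad x), laplacian,
        real_inner_comm]
      ring
  simp only [h1] at h0
  rw [integral_sub, sub_eq_zero] at h0
  · exact h0
  · exact integrable_of_continuous
      ((hgf.bilin dotCLM hgg).isRadiallySmooth isOpen_univ (mem_univ 0)).continuous
  · exact integrable_of_continuous
      ((hd.neg.isRadiallySmooth isOpen_univ (mem_univ 0)).continuous.mul hg.continuous)

/-- The integral over the sphere of a function depending smoothly on time is smooth in time. -/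
lemma IsSmoothInTime.contDiffOn_integral {J : Set ℝ} (hJ : IsOpen J) {f : ℝ → S2 → ℝ}
    (hf : IsSmoothInTime J f) : ContDiffOn ℝ ∞ (fun t => ∫ x, f t x ∂area) J := by
  have hm : MeasurableEmbedding (Subtype.val : S2 → E3) :=
    MeasurableEmbedding.subtype_coe Metric.isClosed_sphere.measurableSet
  -- Pushing the area measure forward to `ℝ³` makes the sphere a compact set inside the open domain
  -- of the radial extension.
  have h := contDiffOn_setIntegral (μ := area.map Subtype.val) (isCompact_sphere (0 : E3) 1) hJ
    (isOpen_prod_compl_zero hJ)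
    (fun z hz => ⟨hz.1, coe_ne_zero (⟨z.2, hz.2⟩ : S2)⟩) (hf.contDiffOn_radialExt hJ)
  refine h.congr fun t _ => ?_
  rw [hm.setIntegral_map]
  simp

/-- A function of mean zero on the sphere is determined by its gradient. -/
lemma eq_of_grad_eq {f g : S2 → ℝ} (hf : IsRadiallySmooth f) (hg : IsRadiallySmooth g)
    (hf0 : ∫ x, f x ∂area = 0) (hg0 : ∫ x, g x ∂area = 0) (h : grad f = grad g) : f = g := by
  have hd : ∀ y ∈ ({0}ᶜ : Set E3),
      HasFDerivAt (fun y => radialExt f y - radialExt g y) (0 : E3 →L[ℝ] ℝ) y := fun y hy => by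
    have h1 := ((hf.contDiffAt hy).differentiableAt (by simp)).hasFDerivAt
    have h2 := ((hg.contDiffAt hy).differentiableAt (by simp)).hasFDerivAt
    refine (h1.sub h2).congr_fderiv ?_
    rw [fderiv_radialExt f hy, fderiv_radialExt g hy, ← smul_sub]
    ext w
    simp only [smul_apply, sub_apply, ← inner_grad, h, sub_self, smul_zero, zero_apply]
  have hconn : IsPreconnected ({0}ᶜ : Set E3) :=
    (isConnected_compl_singleton_of_one_lt_rank (by
      rw [← Module.finrank_eq_rank, finrank_euclideanSpace_fin]; norm_num) 0).isPreconnected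
  have hconst : ∀ x : S2, f x - g x = radialExt f (stdVec 0) - radialExt g (stdVec 0) := fun x => by
    have := isOpen_compl_singleton.is_const_of_fderiv_eq_zero hconn
      (fun y hy => (hd y hy).differentiableAt.differentiableWithinAt)
      (fun y hy => (hd y hy).fderiv) (coe_ne_zero x)
      (show stdVec 0 ∈ ({0}ᶜ : Set E3) from fun h0 => by
        have := congrArg (fun y : E3 => y 0) h0
        simp [stdVec_apply] at this)
    simpa using this
  have hint : ∫ x, (f x - g x) ∂area = 0 := by
    rw [integral_sub (integrable_of_continuous hf.continuous)
      (integrable_of_continuous hg.continuous), hf0, hg0, sub_zero]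
  simp only [hconst, integral_const, smul_eq_mul] at hint
  have hc := (mul_eq_zero.1 hint).resolve_left area_real_univ_ne_zero
  ext x
  linarith [hconst x]

end Integration
end SphereHydro

namespace SphereHydro

open scoped Manifold Topology RealInnerProductSpace EuclideanSpace
open Set Filter MeasureTheory

/-! ### The Euler equations and the vorticity equation -/

section Euler

variable {J : Set ℝ}

lemma grad_sub_const (f : S2 → ℝ) (c : ℝ) : grad (fun x => f x - c) = grad f := by
  ext1 x
  have h : radialExt (fun x => f x - c) =ᶠ[𝓝 (x : E3)] fun y => radialExt f y - c :=
    radialExt_eventuallyEq (fun y hy => by rw [radialExt_of_ne f hy]) (coe_ne_zero x)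
  rw [grad, grad, tangentDeriv, tangentDeriv, h.fderiv_eq, fderiv_sub_const]

lemma grad_neg (f : S2 → ℝ) (x : S2) : grad (fun x => -f x) x = -grad f x := by
  rw [grad, grad, tangentDeriv_neg, map_neg]

lemma cross_coe_cross_coe {v : S2 → E3} (hv : IsTangent v) (x : S2) :
    cross (cross (x : E3) (v x)) (x : E3) = v x := by
  rw [cross_cross_coe, hv x, zero_smul, sub_zero]

/-- A divergence-free tangent field on the sphere that depends smoothly on time has a stream
function of mean zero that depends smoothly on time. -/
theorem exists_stream (hJ : IsOpen J) {v : ℝ → S2 → E3} (hv : IsSmoothInTime J v)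
    (hvt : ∀ t ∈ J, IsTangent (v t)) (hdiv : ∀ t ∈ J, ∀ x, div (v t) x = 0) :
    ∃ ψ : ℝ → S2 → ℝ, IsSmoothInTime J ψ ∧ (∀ t ∈ J, ∫ x, ψ t x ∂area = 0) ∧
      ∀ t ∈ J, v t = skewGrad (ψ t) := by
  -- Since `(x × v) × x = v`, the field `x × v` has curl `div v = 0`; turning its potential's
  -- gradient back recovers `v`.
  obtain ⟨q, hq, hqv⟩ := exists_potential hJ (F := fun t x => cross (x : E3) (v t x))
    (isSmoothInTime_coe.bilin crossCLM hv)
    (fun t _ x => by simp [inner_eq_sum3]; ring)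
    (fun t ht x => by
      rw [curl, funext (cross_coe_cross_coe (hvt t ht))]
      exact hdiv t ht x)
  refine ⟨fun t x => q t x - (area.real univ)⁻¹ * ∫ x, q t x ∂area, ?_, fun t ht => ?_,
    fun t ht => ?_⟩
  · exact hq.sub (isSmoothInTime_of_contDiffOn_time
      (contDiffOn_const.mul (hq.contDiffOn_integral hJ)))
  · rw [integral_sub (integrable_of_continuous (hq.isRadiallySmooth hJ ht).continuous)
      (integrable_const _), integral_const, smul_eq_mul, ← mul_assoc,
      mul_inv_cancel₀ area_real_univ_ne_zero, one_mul, sub_self]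
  · ext1 x
    rw [skewGrad_eq_cross, grad_sub_const, hqv t ht, cross_coe_cross_coe (hvt t ht)]

lemma IsEulerSolution.acceleration_eq {v : ℝ → S2 → E3} {p : ℝ → S2 → ℝ}
    (h : IsEulerSolution J v p) {t : ℝ} (ht : t ∈ J) :
    acceleration v t = fun x => -grad (p t) x :=
  funext (h.momentum_eq t ht)

/-- Taking the curl of the momentum equation eliminates the pressure. -/
theorem IsEulerSolution.exists_isVorticitySolution (hJ : IsOpen J) {v : ℝ → S2 → E3}
    {p : ℝ → S2 → ℝ} (h : IsEulerSolution J v p) :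
    ∃ ψ : ℝ → S2 → ℝ, IsVorticitySolution J (fun t => curl (v t)) ψ ∧
      ∀ t ∈ J, v t = skewGrad (ψ t) := by
  obtain ⟨ψ, hψ, hmean, hvψ⟩ := exists_stream hJ h.smooth_velocity h.tangent h.div_eq_zero
  refine ⟨ψ, ⟨h.smooth_velocity.curl hJ, hψ, hmean, fun t ht x => ?_, fun t ht x => ?_⟩, hvψ⟩
  · have h1 := curl_acceleration hJ h.smooth_velocity h.tangent ht (h.div_eq_zero t ht) x
    have hp := h.smooth_pressure.isRadiallySmooth hJ ht
    rw [h.acceleration_eq ht, curl_neg (hp.differentiableAt_grad x), curl_grad hp, neg_zero] at h1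
    rw [poisson_eq_inner, ← hvψ t ht, ← h1]
  · simp only [hvψ t ht, curl_skewGrad]

lemma IsVorticitySolution.curl_skewGrad_eq {ω ψ : ℝ → S2 → ℝ} (h : IsVorticitySolution J ω ψ)
    {t : ℝ} (ht : t ∈ J) : curl (skewGrad (ψ t)) = ω t :=
  funext fun x => by rw [curl_skewGrad, h.poisson_eq t ht]

/-- The vorticity equation makes the tangent field of accelerations curl-free; the pressure is minus
its potential. -/
theorem IsVorticitySolution.exists_isEulerSolution (hJ : IsOpen J) {ω ψ : ℝ → S2 → ℝ}
    (h : IsVorticitySolution J ω ψ) :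
    ∃ p : ℝ → S2 → ℝ, IsEulerSolution J (fun t => skewGrad (ψ t)) p := by
  have hv := h.smooth_stream.skewGrad hJ
  have hvt : ∀ t ∈ J, IsTangent (skewGrad (ψ t)) := fun t _ => isTangent_skewGrad (ψ t)
  have hdiv : ∀ t ∈ J, ∀ x, div (skewGrad (ψ t)) x = 0 := fun t ht =>
    div_skewGrad (h.smooth_stream.isRadiallySmooth hJ ht)
  obtain ⟨q, hq, hqa⟩ := exists_potential hJ (hv.acceleration hJ)
    (fun t ht => isTangent_acceleration hJ hv hvt ht) (fun t ht x => by
      rw [curl_acceleration hJ hv hvt ht (hdiv t ht), h.curl_skewGrad_eq ht, ← poisson_eq_inner,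
        ← h.vorticity_eq t ht x]
      congr 1
      -- The identity `curl ∇^⊥ψ = ω` is known only on `J`; openness of `J` is what allows it to be
      -- differentiated in time.
      refine Filter.EventuallyEq.deriv_eq ?_
      filter_upwards [hJ.mem_nhds ht] with s hs
      exact congrFun (h.curl_skewGrad_eq hs) x)
  refine ⟨fun t x => -q t x, hv, hq.neg, hvt, fun t ht x => ?_, hdiv⟩
  rw [grad_neg, neg_neg, hqa t ht]
  rfl

lemma IsEulerSolution.congr (hJ : IsOpen J) {v w : ℝ → S2 → E3} {p : ℝ → S2 → ℝ}
    (h : IsEulerSolution J v p) (hw : ∀ t ∈ J, w t = v t) : IsEulerSolution J w p where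
  smooth_velocity := h.smooth_velocity.congr fun t ht x => by rw [hw t ht]
  smooth_pressure := h.smooth_pressure
  tangent t ht := by rw [hw t ht]; exact h.tangent t ht
  momentum_eq t ht x := by
    have h1 : (fun s => w s x) =ᶠ[𝓝 t] fun s => v s x := by
      filter_upwards [hJ.mem_nhds ht] with s hs
      rw [hw s hs]
    rw [h1.deriv_eq, hw t ht]
    exact h.momentum_eq t ht x
  div_eq_zero t ht x := by rw [hw t ht]; exact h.div_eq_zero t ht x

/-- The quarter turn is invertible on tangent vectors, so uniqueness of `ψ` reduces to uniqueness
for a given gradient. -/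
lemma grad_eq_of_skewGrad (ψ : S2 → ℝ) (x : S2) : grad ψ x = cross (x : E3) (skewGrad ψ x) := by
  rw [skewGrad, ← crossCLM_apply (x : E3) (-_), map_neg, crossCLM_apply, neg_cross,
    cross_cross_coe, inner_coe_grad, zero_smul, sub_zero]

end Euler
end SphereHydro

theorem mainTheorem2 (J : Set ℝ) (hJ : IsOpen J) :
    -- the Euler equations for `v` are the vorticity equation for `ω = curl v`, `v = ∇^⊥ψ`
    (∀ v : ℝ → SphereHydro.S2 → SphereHydro.E3,
      (∃ p : ℝ → SphereHydro.S2 → ℝ, SphereHydro.IsEulerSolution J v p) ↔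
        ∃ ψ : ℝ → SphereHydro.S2 → ℝ,
          SphereHydro.IsVorticitySolution J (fun t => SphereHydro.curl (v t)) ψ ∧
            ∀ t ∈ J, v t = SphereHydro.skewGrad (ψ t)) ∧
    -- the stream function of mean zero of a velocity field is unique
    (∀ ψ₁ ψ₂ : SphereHydro.S2 → ℝ, SphereHydro.IsSmooth ψ₁ → SphereHydro.IsSmooth ψ₂ →
      ∫ x, ψ₁ x ∂SphereHydro.area = 0 → ∫ x, ψ₂ x ∂SphereHydro.area = 0 →
      SphereHydro.skewGrad ψ₁ = SphereHydro.skewGrad ψ₂ → ψ₁ = ψ₂) ∧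
    -- every solution of the vorticity equation comes from a solution of the Euler equations
    (∀ ω ψ : ℝ → SphereHydro.S2 → ℝ, SphereHydro.IsVorticitySolution J ω ψ →
      (∃ p : ℝ → SphereHydro.S2 → ℝ,
        SphereHydro.IsEulerSolution J (fun t => SphereHydro.skewGrad (ψ t)) p) ∧
      (∀ t ∈ J, SphereHydro.curl (SphereHydro.skewGrad (ψ t)) = ω t) ∧
      -- `ω` represents the momentum variable of `ψ` for the Dirichlet inner product
      (∀ t ∈ J, ∀ ξ : SphereHydro.S2 → ℝ, SphereHydro.IsSmooth ξ →
        ∫ x, inner ℝ (SphereHydro.grad (ψ t) x) (SphereHydro.grad ξ x) ∂SphereHydro.area =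
          ∫ x, ω t x * ξ x ∂SphereHydro.area)) := by
  refine ⟨fun v => ⟨fun ⟨p, h⟩ => h.exists_isVorticitySolution hJ, fun ⟨ψ, h, hv⟩ => ?_⟩,
    fun ψ₁ ψ₂ h₁ h₂ hm₁ hm₂ h => ?_, fun ω ψ h => ⟨h.exists_isEulerSolution hJ,
      fun t ht => h.curl_skewGrad_eq ht, fun t ht ξ hξ => ?_⟩⟩
  · obtain ⟨p, hp⟩ := h.exists_isEulerSolution hJ
    exact ⟨p, hp.congr hJ hv⟩
  · refine SphereHydro.eq_of_grad_eq h₁.isRadiallySmooth h₂.isRadiallySmooth hm₁ hm₂ ?_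
    ext1 x
    rw [SphereHydro.grad_eq_of_skewGrad, SphereHydro.grad_eq_of_skewGrad, h]
  · rw [SphereHydro.integral_inner_grad_grad (h.smooth_stream.isRadiallySmooth hJ ht)
      hξ.isRadiallySmooth]
    simp only [h.poisson_eq t ht]
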